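/- Let $n\ge 2$, $m\ge 1$, let $D\subset\mathbb{R}^n$ be a domain (a nonempty connected open set), $x_0\in D$ and $M\in[0,\infty)$. For a nondecreasing function $\varphi:[0,\infty]\to[0,\infty]$ let $\mathfrak{F}^{\varphi}_M$ denote the family of all continuous maps $f:D\to\mathbb{R}^m$ of the class $W^{1,1}_{\rm loc}(D)$ with $f(x_0)=0$ and $$\int_D \varphi(|\nabla f|)\,dm(x)\le M,\qquad |\nabla f|=\Big(\sum_{i,j}\big(\tfrac{\partial f_i}{\partial x_j}\big)^2\Big)^{1/2},$$ where the derivatives are distributional; write $\mathfrak{F}^p_M$ when $\varphi(t)=t^p$. Put $t_0=\sup\{t:\varphi(t)=0\}$, with $t_0=0$ if $\varphi$ has no zeros. A family of continuous maps $D\to\mathbb{R}^m$ is called compact with respect to locally uniform convergence if every sequence in it has a subsequence that converges, uniformly on each compact subset of $D$, to a continuous map, and if every limit, uniform on compact subsets of $D$, of a sequence in the family belongs to the family. Suppose that $\varphi:[0,\infty]\to[0,\infty]$ is nonconstant, continuous (in the topology of the extended half-line), nondecreasing and convex, and that for some $t_*\in(t_0,\infty)$ and some $\alpha\in(0,1/(n-1))$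 $$\int_{t_*}^{\infty}\left(\frac{t}{\varphi(t)}\right)^{\alpha}dt<\infty ,$$ where $t/\varphi(t)=0$ if $\varphi(t)=\infty$. Then $\mathfrak{F}^{\varphi}_M$ is compact with respect to locally uniform convergence. In particular, $\mathfrak{F}^{p}_M$ is compact with respect to locally uniform convergence for every $p\in(n,\infty)$. -/

import Mathlib

open scoped ENNReal NNReal ContDiff

/-- Lebesgue measure on a subset `D` of `ℝⁿ`. -/
noncomputable def lebesgueOn {n : ℕ} (D : Set (EuclideanSpace ℝ (Fin n))) :
    MeasureTheory.Measure D :=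
  MeasureTheory.Measure.comap Subtype.val MeasureTheory.volume

/-- `HasWeakPartialDeriv D i u v`: the locally integrable function `v : D → ℝ` is the
distributional derivative in the variable `x_i` of the locally integrable function `u : D → ℝ`.
Test functions are smooth functions on `ℝⁿ` whose support is compact and contained in `D`. -/
def HasWeakPartialDeriv {n : ℕ} (D : Set (EuclideanSpace ℝ (Fin n))) (i : Fin n)
    (u v : D → ℝ) : Prop :=
  MeasureTheory.LocallyIntegrable u (lebesgueOn D) ∧
    MeasureTheory.LocallyIntegrable v (lebesgueOn D) ∧
    ∀ η : EuclideanSpace ℝ (Fin n) → ℝ, ContDiff ℝ ∞ η → HasCompactSupport η → tsupport η ⊆ D →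
      ∫ x, u x * fderiv ℝ η x (EuclideanSpace.single i 1) ∂(lebesgueOn D) =
        - ∫ x, v x * η x ∂(lebesgueOn D)

/-- `IsWeakGradient D f G`: the matrix field `G` is the gradient of `f : D → ℝᵐ`, that is, `G x i j`
is the distributional derivative of the component `f_i` in the variable `x_j`. A map `f` is of the
class `W^{1,1}_loc(D)` if and only if it has such a (locally integrable) gradient, which is then
unique up to a null set. -/
def IsWeakGradient {n m : ℕ} (D : Set (EuclideanSpace ℝ (Fin n)))
    (f : D → EuclideanSpace ℝ (Fin m)) (G : D → Matrix (Fin m) (Fin n) ℝ) : Prop :=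
  ∀ (i : Fin m) (j : Fin n), HasWeakPartialDeriv D j (fun x => f x i) (fun x => G x i j)

/-- The modulus `|A| = (∑ A_{ij}²)^{1/2}` of a matrix. -/
noncomputable def gradModulus {n m : ℕ} (A : Matrix (Fin m) (Fin n) ℝ) : ℝ :=
  Real.sqrt (∑ i, ∑ j, A i j ^ 2)

/-- The family of all continuous maps `f : D → ℝᵐ` of the class `W^{1,1}_loc(D)` with `f x₀ = 0`
and `∫_D φ(|∇f|) ≤ M`. -/
def orliczSobolevFamily {n : ℕ} (m : ℕ) (D : Set (EuclideanSpace ℝ (Fin n))) (x₀ : D)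
    (φ : ℝ≥0∞ → ℝ≥0∞) (M : ℝ≥0) : Set (D → EuclideanSpace ℝ (Fin m)) :=
  {f | Continuous f ∧ f x₀ = 0 ∧ ∃ G : D → Matrix (Fin m) (Fin n) ℝ, IsWeakGradient D f G ∧
    ∫⁻ x, φ (ENNReal.ofReal (gradModulus (G x))) ∂(lebesgueOn D) ≤ M}

/-- Uniform convergence on each compact set. -/
def ConvergesOnCompacts {X Y : Type*} [MetricSpace X] [MetricSpace Y]
    (f : ℕ → X → Y) (g : X → Y) : Prop :=
  ∀ C : Set X, IsCompact C → TendstoUniformlyOn f g Filter.atTop C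

/-- Normal family: every sequence in it has a subsequence that converges uniformly on compact sets
to a continuous map. -/
def IsNormalFamily {X Y : Type*} [MetricSpace X] [MetricSpace Y] (F : Set (X → Y)) : Prop :=
  ∀ f : ℕ → X → Y, (∀ k, f k ∈ F) → ∃ s : ℕ → ℕ, StrictMono s ∧ ∃ g : X → Y, Continuous g ∧
    ConvergesOnCompacts (fun k => f (s k)) g

/-- A family closed with respect to uniform convergence on compact sets. -/
def IsClosedFamily {X Y : Type*} [MetricSpace X] [MetricSpace Y] (F : Set (X → Y)) : Prop :=
  ∀ (f : ℕ → X → Y) (g : X → Y), (∀ k, f k ∈ F) → ConvergesOnCompacts f g → g ∈ F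

/-- Compact family of continuous maps: continuous members, normal and closed. -/
def IsCompactFamily {X Y : Type*} [MetricSpace X] [MetricSpace Y] (F : Set (X → Y)) : Prop :=
  (∀ f ∈ F, Continuous f) ∧ IsNormalFamily F ∧ IsClosedFamily F

/-- The number `t₀ = sup {t : φ(t) = 0}`, which is `0` if `φ` has no zeros. -/
noncomputable def zeroThreshold (φ : ℝ≥0∞ → ℝ≥0∞) : ℝ≥0∞ :=
  sSup {t | φ t = 0}

/-! Monotonicity turns the integral condition into power growth. On `(t/2, t]` the integrand is at
least `(t / (2 φ t)) ^ α`, so the finite integral forces `t ^ p ≤ C (1 + φ t)` with `p = 1 + 1/α`,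
and `α < 1/(n-1)` means exactly `p > n`. Gradients in the family are therefore bounded in `L^p` on
each ball in `D`, by a constant common to the family (`rpow_le_of_lintegral_div_rpow_lt_top`).

Normality follows from Morrey's inequality (`exists_norm_sub_le_morreyConst`). The derivative in `s`
of a kernel average at scale `s` is the integral of `U` against a divergence, hence of the weak
gradient against a test field, and Hölder bounds it by a multiple of `s ^ (-n/p)`. This is
integrable at `0`, which gives local equicontinuity. Connectedness spreads boundedness from `x₀` to
every point, and Arzelà–Ascoli applies.

Closedness follows from convexity. Since `p > 2`, the gradients lie in a ball of `L²(ν)` for a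
finite measure `ν` comparable with Lebesgue measure on compact sets. Gradients of admissible maps
that are as close to the limit `g` as a tail of the sequence form decreasing midpoint-convex sets,
and elements of almost minimal norm converge strongly
(`exists_tendsto_selection_of_midpointConvex`). The strong limit is the weak gradient of `g`, and
Fatou's lemma preserves the energy bound. -/

open MeasureTheory Set Filter Topology Metric

/-! ### Power growth from the integral condition, and the model case of powers. -/

/-- A nondecreasing `φ` with `∫ (t / φ t) ^ α < ∞` grows at least as fast as `t ^ (1 + 1 / α)`. -/
theorem rpow_le_of_lintegral_div_rpow_lt_top {φ : ℝ≥0∞ → ℝ≥0∞} (hφ : Monotone φ) {a α : ℝ}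
    (ha : 0 < a) (hα : 0 < α) (hpos : φ (ENNReal.ofReal a) ≠ 0)
    (hint : ∫⁻ t in Ioi a, (ENNReal.ofReal t / φ (ENNReal.ofReal t)) ^ α < ⊤) :
    ∃ C : ℝ≥0, ∀ t : ℝ≥0∞, t ≠ ⊤ → t ^ (1 + 1 / α) ≤ C * (1 + φ t) := by
  set I := ∫⁻ t in Ioi a, (ENNReal.ofReal t / φ (ENNReal.ofReal t)) ^ α with hI
  set p : ℝ := 1 + 1 / α with hp
  have hp0 : 0 < p := by positivity
  have hC : (2 : ℝ≥0∞) ^ p * I ^ (1 / α) + ENNReal.ofReal (2 * a) ^ p + 1 ≠ ⊤ := by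
    have h1 : I ^ (1 / α) ≠ ⊤ := (ENNReal.rpow_lt_top_of_nonneg (by positivity) hint.ne).ne
    have h2 : (2 : ℝ≥0∞) ^ p ≠ ⊤ := (ENNReal.rpow_lt_top_of_nonneg hp0.le (by simp)).ne
    have h3 : ENNReal.ofReal (2 * a) ^ p ≠ ⊤ :=
      (ENNReal.rpow_lt_top_of_nonneg hp0.le ENNReal.ofReal_ne_top).ne
    exact ENNReal.add_ne_top.2 ⟨ENNReal.add_ne_top.2 ⟨ENNReal.mul_ne_top h2 h1, h3⟩,
      ENNReal.one_ne_top⟩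
  refine ⟨((2 : ℝ≥0∞) ^ p * I ^ (1 / α) + ENNReal.ofReal (2 * a) ^ p + 1).toNNReal, ?_⟩
  intro t ht
  rw [ENNReal.coe_toNNReal hC]
  set s := t.toReal with hs
  have hts : t = ENNReal.ofReal s := (ENNReal.ofReal_toReal ht).symm
  have hs0 : 0 ≤ s := ENNReal.toReal_nonneg
  -- The threshold `2 * a` ensures that `(s/2, s]` lies in the domain of integration; smaller `s`
  -- are absorbed by the second term of the constant.
  rcases lt_or_ge s (2 * a) with h | h
  · calc t ^ p ≤ ENNReal.ofReal (2 * a) ^ p := by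
          rw [hts]; exact ENNReal.rpow_le_rpow (ENNReal.ofReal_le_ofReal h.le) hp0.le
      _ ≤ (2 : ℝ≥0∞) ^ p * I ^ (1 / α) + ENNReal.ofReal (2 * a) ^ p + 1 :=
          le_self_add.trans' le_add_self
      _ ≤ _ := le_mul_of_one_le_right' le_self_add
  · by_cases htop : φ t = ⊤
    · simp [htop, ENNReal.mul_top]
    have hφt : φ t ≠ 0 := by
      intro h0
      refine hpos (le_antisymm (h0 ▸ hφ ?_) bot_le)
      rw [hts]; exact ENNReal.ofReal_le_ofReal (by linarith)
    set σ := ENNReal.ofReal (s / 2) with hσ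
    -- On `(s/2, s]` the numerator is at least `σ` and the denominator at most `φ t`; the interval
    -- has length `σ`.
    have hle : (σ / φ t) ^ α * σ ≤ I := by
      have h1 : ∫⁻ _ in Ioc (s / 2) s, (σ / φ t) ^ α = (σ / φ t) ^ α * σ := by
        rw [setLIntegral_const, Real.volume_Ioc]
        congr 2; ring
      rw [← h1]
      calc _ ≤ ∫⁻ u in Ioc (s / 2) s, (ENNReal.ofReal u / φ (ENNReal.ofReal u)) ^ α := by
            refine setLIntegral_mono_ae' measurableSet_Ioc (ae_of_all _ fun u hu => ?_)
            refine ENNReal.rpow_le_rpow (ENNReal.div_le_div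
              (ENNReal.ofReal_le_ofReal hu.1.le) (hφ ?_)) hα.le
            rw [hts]; exact ENNReal.ofReal_le_ofReal hu.2
        _ ≤ I := lintegral_mono_set fun u hu => by
            have := hu.1; simp only [mem_Ioi]; linarith
    have h2 : σ ^ p ≤ I ^ (1 / α) * φ t := by
      have h3 := ENNReal.rpow_le_rpow hle (z := 1 / α) (by positivity)
      rw [ENNReal.mul_rpow_of_nonneg _ _ (by positivity), ← ENNReal.rpow_mul,
        mul_one_div_cancel hα.ne', ENNReal.rpow_one] at h3
      rw [hp, ENNReal.rpow_add_of_nonneg _ _ zero_le_one (by positivity), ENNReal.rpow_one,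
        ← ENNReal.div_le_iff hφt htop, div_eq_mul_inv]
      rwa [mul_right_comm, ← div_eq_mul_inv]
    have h4 : t = 2 * σ := by
      rw [hts, hσ, show (2 : ℝ≥0∞) = ENNReal.ofReal 2 by simp,
        ← ENNReal.ofReal_mul (by norm_num)]
      congr 1; ring
    calc t ^ p = 2 ^ p * σ ^ p := by rw [h4, ENNReal.mul_rpow_of_nonneg _ _ hp0.le]
      _ ≤ 2 ^ p * I ^ (1 / α) * φ t := by rw [mul_assoc]; gcongr
      _ ≤ _ := by
        refine mul_le_mul' ?_ le_add_self
        rw [add_assoc]; exact le_self_add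

theorem zeroThreshold_rpow {p : ℝ} (hp : 0 < p) : zeroThreshold (fun t => t ^ p) = 0 := by
  simp [zeroThreshold, ENNReal.rpow_eq_zero_iff, hp, hp.not_gt]

theorem convexOn_ennreal_rpow {p : ℝ} (hp : 1 ≤ p) :
    ConvexOn ℝ≥0 univ (fun t : ℝ≥0∞ => t ^ p) := by
  refine ⟨convex_univ, fun x _ y _ a b _ _ hab => ?_⟩
  have := ENNReal.rpow_arith_mean_le_arith_mean2_rpow a b x y (by exact_mod_cast hab) hp
  simpa [ENNReal.smul_def] using this

/-- The integrand is `t ^ ((1 - p) * α)`, and the lower bound on `α` makes this exponent less than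
`-1`. -/
theorem lintegral_div_rpow_rpow_lt_top {p α : ℝ} (hp : 1 < p) (hα : 1 / (p - 1) < α) :
    ∫⁻ t in Ioi (1 : ℝ), (ENNReal.ofReal t / ENNReal.ofReal t ^ p) ^ α < ⊤ := by
  have hp1 : 0 < p - 1 := by linarith
  have hα0 : 0 < α := lt_trans (by positivity) hα
  have he : (1 - p) * α < -1 := by
    rw [div_lt_iff₀ hp1] at hα; nlinarith
  have h := (integrableOn_Ioi_rpow_of_lt he one_pos).lintegral_lt_top
  refine lt_of_le_of_lt (le_of_eq ?_) h
  refine setLIntegral_congr_fun measurableSet_Ioi fun t ht => ?_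
  have ht0 : (0 : ℝ) < t := lt_trans one_pos ht
  rw [ENNReal.ofReal_rpow_of_pos ht0, ← ENNReal.ofReal_div_of_pos (by positivity),
    ENNReal.ofReal_rpow_of_pos (by positivity), Real.rpow_mul ht0.le,
    Real.rpow_sub ht0, Real.rpow_one]

/-! ### Kernel averages as functions of the scale. -/

section Dilation

variable {E : Type*} [NormedAddCommGroup E] [NormedSpace ℝ E]

/-- The bracket is the divergence of the field `w ↦ κ(w) w` at `w = s⁻¹ • v` when `n` is the
dimension; this form is what later allows integration by parts. -/
theorem hasDerivAt_inv_pow_mul_dilation {κ : E → ℝ} (hκ : Differentiable ℝ κ) (n : ℕ) (v : E)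
    {s : ℝ} (hs : s ≠ 0) :
    HasDerivAt (fun s : ℝ => (s ^ n)⁻¹ * κ (s⁻¹ • v))
      (-(s ^ (n + 1))⁻¹ * (n * κ (s⁻¹ • v) + fderiv ℝ κ (s⁻¹ • v) (s⁻¹ • v))) s := by
  have h1 : HasDerivAt (fun s : ℝ => s⁻¹ • v) (-(s ^ 2)⁻¹ • v) s :=
    (hasDerivAt_inv hs).smul_const v
  have h2 := (hκ (s⁻¹ • v)).hasFDerivAt.comp_hasDerivAt s h1
  have h3 : HasDerivAt (fun s : ℝ => (s ^ n)⁻¹) (-(n * s ^ (n - 1)) / (s ^ n) ^ 2) s :=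
    (hasDerivAt_pow n s).fun_inv (pow_ne_zero n hs)
  refine (h3.mul h2).congr_deriv ?_
  have e : fderiv ℝ κ (s⁻¹ • v) (-(s ^ 2)⁻¹ • v) =
      -s⁻¹ * fderiv ℝ κ (s⁻¹ • v) (s⁻¹ • v) := by
    rw [← smul_eq_mul, ← map_smul, smul_smul]
    congr 2; field_simp
  rw [e, Function.comp_apply]
  rcases n with _ | n
  · simp
  · simp only [Nat.add_sub_cancel]
    field_simp
    ring

theorem hasDerivAt_integral_mul_dilation [MeasurableSpace E] [BorelSpace E]
    [SecondCountableTopology E] {μ : Measure E} {U : E → ℝ} (hU : Integrable U μ)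
    {κ : E → ℝ} (hκ : ContDiff ℝ ∞ κ) (hκc : HasCompactSupport κ) (n : ℕ) (x : E)
    {s : ℝ} (hs : 0 < s) :
    HasDerivAt (fun s : ℝ => ∫ y, U y * ((s ^ n)⁻¹ * κ (s⁻¹ • (y - x))) ∂μ)
      (∫ y, U y * (-(s ^ (n + 1))⁻¹ * (n * κ (s⁻¹ • (y - x)) +
        fderiv ℝ κ (s⁻¹ • (y - x)) (s⁻¹ • (y - x)))) ∂μ) s := by
  set ξ : E → ℝ := fun w => n * κ w + fderiv ℝ κ w w with hξ
  have hfd : Continuous (fderiv ℝ κ) := hκ.continuous_fderiv (by simp)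
  have hξc : Continuous ξ := (continuous_const.mul hκ.continuous).add (hfd.clm_apply continuous_id)
  have hξs : HasCompactSupport ξ := by
    refine HasCompactSupport.add hκc.mul_left ?_
    refine (hκc.fderiv ℝ).mono fun w hw => ?_
    rw [Function.mem_support] at hw ⊢
    intro h; exact hw (by simp [h])
  obtain ⟨C, hC⟩ := hξs.exists_bound_of_continuous hξc
  obtain ⟨C', hC'⟩ := hκc.exists_bound_of_continuous hκ.continuous
  have hmeas : ∀ {g : E → ℝ}, Continuous g → AEStronglyMeasurable (fun y => U y * g y) μ :=
    fun hg => hU.aestronglyMeasurable.mul hg.aestronglyMeasurable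
  -- Restricting to scales above `s / 2` keeps the negative powers of the scale bounded, so a
  -- multiple of `‖U‖` dominates.
  refine (hasDerivAt_integral_of_dominated_loc_of_deriv_le
    (F := fun (s : ℝ) y => U y * ((s ^ n)⁻¹ * κ (s⁻¹ • (y - x))))
    (F' := fun (s : ℝ) y => U y * (-(s ^ (n + 1))⁻¹ * ξ (s⁻¹ • (y - x))))
    (bound := fun y => ‖U y‖ * (((s / 2) ^ (n + 1))⁻¹ * C)) (s := Ioi (s / 2))
    (Ioi_mem_nhds (by linarith)) ?_ ?_ ?_ ?_ (hU.norm.mul_const _) ?_).2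
  · exact Eventually.of_forall fun t =>
      hmeas (continuous_const.mul (hκ.continuous.comp (by fun_prop)))
  · refine hU.mul_bdd (c := (s ^ n)⁻¹ * C')
      (continuous_const.mul (hκ.continuous.comp (by fun_prop))).aestronglyMeasurable
      (ae_of_all _ fun y => ?_)
    rw [norm_mul, Real.norm_of_nonneg (by positivity)]
    gcongr; exact hC' _
  · exact hmeas (continuous_const.mul (hξc.comp (by fun_prop)))
  · refine ae_of_all _ fun y t ht => ?_
    have ht' : s / 2 < t := ht
    rw [norm_mul, norm_mul, norm_neg, norm_inv, norm_pow,
      Real.norm_of_nonneg (show 0 ≤ t by linarith)]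
    have hs2 : 0 < s / 2 := by linarith
    gcongr
    exact hC _
  · refine ae_of_all _ fun y t ht => ?_
    have ht' : s / 2 < t := ht
    exact (hasDerivAt_inv_pow_mul_dilation (hκ.differentiable (by simp)) n (y - x)
      (by linarith : t ≠ 0)).const_mul _

end Dilation

section Euclidean

variable {n : ℕ}

local notation "E" => EuclideanSpace ℝ (Fin n)

/-- Together with the formula for the scale derivative this gives `∂ₛ (s⁻ⁿ κ(w)) = -s⁻ⁿ div_y (κ(w)
w)` with `w = s⁻¹ • (y - x)`. -/
theorem sum_fderiv_coord_mul_dilation {κ : E → ℝ} (hκ : Differentiable ℝ κ) (x y : E) (s : ℝ) :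
    ∑ j, fderiv ℝ (fun y : E => (s⁻¹ • (y - x)) j * κ (s⁻¹ • (y - x))) y
      (EuclideanSpace.single j 1) =
    s⁻¹ * (n * κ (s⁻¹ • (y - x)) + fderiv ℝ κ (s⁻¹ • (y - x)) (s⁻¹ • (y - x))) := by
  set w := s⁻¹ • (y - x) with hw
  have h1 : HasFDerivAt (fun y : E => s⁻¹ • (y - x)) (s⁻¹ • ContinuousLinearMap.id ℝ E) y :=
    ((hasFDerivAt_id y).sub_const x).const_smul s⁻¹
  have h2 : ∀ j, fderiv ℝ (fun y : E => (s⁻¹ • (y - x)) j * κ (s⁻¹ • (y - x))) y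
      (EuclideanSpace.single j 1) =
      s⁻¹ * κ w + s⁻¹ * (w j * fderiv ℝ κ w (EuclideanSpace.single j 1)) := by
    intro j
    have h3 : HasFDerivAt (fun y : E => (s⁻¹ • (y - x)) j)
        ((EuclideanSpace.proj j : E →L[ℝ] ℝ).comp (s⁻¹ • ContinuousLinearMap.id ℝ E)) y :=
      (EuclideanSpace.proj j : E →L[ℝ] ℝ).hasFDerivAt.comp y h1
    have h4 := (hκ w).hasFDerivAt.comp y h1
    have h5 := h3.mul h4
    rw [show (fun y : E => (s⁻¹ • (y - x)) j * κ (s⁻¹ • (y - x))) =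
      (fun y : E => (s⁻¹ • (y - x)) j) * (κ ∘ fun y : E => s⁻¹ • (y - x)) from rfl, h5.fderiv]
    simp [← hw]
    ring
  simp only [h2, Finset.sum_add_distrib, ← Finset.mul_sum]
  have h6 : fderiv ℝ κ w w = ∑ j, w j * fderiv ℝ κ w (EuclideanSpace.single j 1) := by
    have h7 := congrArg (fderiv ℝ κ w) ((EuclideanSpace.basisFun (Fin n) ℝ).sum_repr w)
    rw [map_sum] at h7
    simpa using h7.symm
  rw [h6]
  simp
  ring

end Euclidean

/-! ### Morrey's inequality. -/

section Morrey

/-- The constant in Morrey's inequality for averages against a kernel bounded by `C`. -/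
noncomputable def morreyConst (n : ℕ) (p C : ℝ) (A : ℝ≥0) : ℝ :=
  n * (2 * C) * (A : ℝ) ^ (1 / p) *
        (2 ^ n * (volume (closedBall (0 : EuclideanSpace ℝ (Fin n)) 1)).toReal) ^ (1 - 1 / p)

variable {n : ℕ}

local notation "E" => EuclideanSpace ℝ (Fin n)

/-- Hölder's inequality on a ball. -/
theorem setLIntegral_enorm_closedBall_le {p : ℝ} (hp : 1 < p) {K : Set E} {V : E → ℝ}
    (hV : AEStronglyMeasurable V (volume.restrict K)) {A : ℝ≥0}
    (hA : ∫⁻ y in K, ‖V y‖ₑ ^ p ≤ A) {x : E} {r : ℝ} (hr : 0 ≤ r) (hK : closedBall x r ⊆ K) :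
    ∫⁻ y in closedBall x r, ‖V y‖ₑ ≤ ENNReal.ofReal ((A : ℝ) ^ (1 / p) *
      (r ^ n * (volume (closedBall (0 : E) 1)).toReal) ^ (1 - 1 / p)) := by
  have h0 : 0 < p := by linarith
  have hp' : 0 ≤ 1 - 1 / p := by rw [sub_nonneg, div_le_one h0]; exact hp.le
  have hmono : volume.restrict (closedBall x r) ≤ volume.restrict K :=
    Measure.restrict_mono hK le_rfl
  have h1 := eLpNorm'_le_eLpNorm'_mul_rpow_measure_univ (p := 1) (q := p) zero_lt_one hp.le
    (hV.mono_measure hmono)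
  simp only [eLpNorm', ENNReal.rpow_one, div_one, Measure.restrict_apply_univ] at h1
  refine h1.trans ?_
  rw [ENNReal.ofReal_mul (by positivity)]
  gcongr
  · rw [← ENNReal.ofReal_rpow_of_nonneg A.coe_nonneg (by positivity), ENNReal.ofReal_coe_nnreal]
    gcongr
    exact (lintegral_mono' hmono le_rfl).trans hA
  · rw [← ENNReal.ofReal_rpow_of_nonneg (by positivity) hp', Measure.addHaar_closedBall' _ _ hr,
      ENNReal.ofReal_mul (by positivity), ENNReal.ofReal_toReal measure_closedBall_lt_top.ne]
    simp

/-- The integrals of a function against the dilations of a smooth kernel towards a point `x`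
oscillate at most by the `L^p` norm of the weak gradient. -/
theorem norm_deriv_integral_dilation_le {p : ℝ} (hp : 1 < p) {K : Set E}
    {U : E → ℝ} {V : Fin n → E → ℝ} {A : ℝ≥0} (hV : ∀ j, IntegrableOn (V j) K)
    (hA : ∀ j, ∫⁻ y in K, ‖V j y‖ₑ ^ p ≤ A)
    (hU : IntegrableOn U K)
    (hweak : ∀ j, ∀ η : E → ℝ, ContDiff ℝ ∞ η → HasCompactSupport η → tsupport η ⊆ K →
      ∫ y in K, U y * fderiv ℝ η y (EuclideanSpace.single j 1) = - ∫ y in K, V j y * η y)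
    {κ : E → ℝ} (hκ : ContDiff ℝ ∞ κ) (hκs : tsupport κ ⊆ closedBall 0 2) {C : ℝ}
    (hC : ∀ w, ‖κ w‖ ≤ C) {x : E} {s : ℝ} (hs : 0 < s) (hK : closedBall x (2 * s) ⊆ K) :
    ‖∫ y in K, U y * (-(s ^ (n + 1))⁻¹ * (n * κ (s⁻¹ • (y - x)) +
        fderiv ℝ κ (s⁻¹ • (y - x)) (s⁻¹ • (y - x))))‖ ≤
      morreyConst n p C A * s ^ (-(n / p)) := by
  have hC0 : 0 ≤ C := (norm_nonneg _).trans (hC 0)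
  set S := closedBall x (2 * s) with hS
  set v := (volume (closedBall (0 : E) 1)).toReal with hv
  have hv0 : 0 ≤ v := ENNReal.toReal_nonneg
  -- The components of the field whose divergence is the scale derivative. They serve as test
  -- functions, supported in the ball of radius `2 * s` and bounded by `2 * C`, because `‖w‖ ≤ 2` on
  -- the support of `κ`.
  set η : Fin n → E → ℝ := fun j y => (s⁻¹ • (y - x)) j * κ (s⁻¹ • (y - x)) with hη
  have hηsmooth : ∀ j, ContDiff ℝ ∞ (η j) := fun j => by
    have h1 : ContDiff ℝ ∞ fun y : E => s⁻¹ • (y - x) := by fun_prop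
    exact ((EuclideanSpace.proj j : E →L[ℝ] ℝ).contDiff.comp h1).mul (hκ.comp h1)
  have hηzero : ∀ j y, y ∉ S → η j y = 0 := fun j y hy => by
    have : κ (s⁻¹ • (y - x)) = 0 := by
      by_contra hne
      have h1 := hκs (subset_tsupport κ hne)
      rw [mem_closedBall_zero_iff, norm_smul, norm_inv, Real.norm_of_nonneg hs.le,
        inv_mul_le_iff₀ hs] at h1
      exact hy (by rw [hS, mem_closedBall, dist_eq_norm]; linarith)
    simp [hη, this]
  have hηts : ∀ j, tsupport (η j) ⊆ S := fun j =>
    closure_minimal (fun y hy => by by_contra h; exact hy (hηzero j y h)) isClosed_closedBall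
  have hηc : ∀ j, HasCompactSupport (η j) := fun j =>
    (isCompact_closedBall x (2 * s)).of_isClosed_subset (isClosed_tsupport _) (hηts j)
  have hηb : ∀ j y, ‖η j y‖ ≤ 2 * C := fun j y => by
    by_cases hw : κ (s⁻¹ • (y - x)) = 0
    · simp only [hη, hw, mul_zero, norm_zero]; positivity
    · have h1 := hκs (subset_tsupport κ hw)
      rw [mem_closedBall_zero_iff] at h1
      rw [norm_mul]
      exact mul_le_mul ((PiLp.norm_apply_le _ j).trans h1) (hC _) (norm_nonneg _) (by norm_num)
  have hderint : ∀ j, IntegrableOn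
      (fun y => U y * fderiv ℝ (η j) y (EuclideanSpace.single j 1)) K := fun j => by
    have h1 : Continuous fun y => fderiv ℝ (η j) y (EuclideanSpace.single j 1) :=
      ((hηsmooth j).continuous_fderiv (by simp)).clm_apply continuous_const
    have h2 : HasCompactSupport fun y => fderiv ℝ (η j) y (EuclideanSpace.single j 1) :=
      (hηc j).fderiv_apply ℝ _
    obtain ⟨B, hB⟩ := h2.exists_bound_of_continuous h1
    exact hU.mul_bdd h1.aestronglyMeasurable (ae_of_all _ hB)
  have hid : ∫ y in K, U y * (-(s ^ (n + 1))⁻¹ * (n * κ (s⁻¹ • (y - x)) +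
        fderiv ℝ κ (s⁻¹ • (y - x)) (s⁻¹ • (y - x)))) = (s ^ n)⁻¹ * ∑ j, ∫ y in K, V j y * η j y := by
    have h1 : ∀ y, U y * (-(s ^ (n + 1))⁻¹ * (n * κ (s⁻¹ • (y - x)) +
        fderiv ℝ κ (s⁻¹ • (y - x)) (s⁻¹ • (y - x)))) =
        -(s ^ n)⁻¹ * ∑ j, U y * fderiv ℝ (η j) y (EuclideanSpace.single j 1) := fun y => by
      rw [← Finset.mul_sum, sum_fderiv_coord_mul_dilation (hκ.differentiable (by simp))]
      field_simp
      ring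
    simp_rw [h1]
    rw [integral_const_mul, integral_finsetSum _ fun j _ => hderint j, neg_mul, ← mul_neg,
      ← Finset.sum_neg_distrib]
    congr 1
    refine Finset.sum_congr rfl fun j _ => ?_
    rw [hweak j (η j) (hηsmooth j) (hηc j) ((hηts j).trans hK), neg_neg]
  have hbound : ∀ j, ‖∫ y in K, V j y * η j y‖ ≤
      2 * C * ((A : ℝ) ^ (1 / p) * ((2 * s) ^ n * v) ^ (1 - 1 / p)) := fun j => by
    have hVS : IntegrableOn (V j) S := (hV j).mono_set hK
    have hm : MeasurableSet S := isClosed_closedBall.measurableSet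
    have h1 : ‖∫ y in K, V j y * η j y‖ ≤ ∫ y in K, S.indicator (fun y => 2 * C * ‖V j y‖) y := by
      refine norm_integral_le_of_norm_le ((hV j).norm.const_mul _ |>.indicator hm)
        (ae_of_all _ fun y => ?_)
      by_cases hy : y ∈ S
      · rw [indicator_of_mem hy, norm_mul, mul_comm]
        gcongr; exact hηb j y
      · simp [indicator_of_notMem hy, hηzero j y hy]
    refine h1.trans ?_
    rw [setIntegral_indicator hm, inter_eq_self_of_subset_right hK, integral_const_mul,
      integral_norm_eq_lintegral_enorm hVS.aestronglyMeasurable]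
    gcongr
    exact ENNReal.toReal_le_of_le_ofReal (by positivity)
      (setLIntegral_enorm_closedBall_le hp (hV j).aestronglyMeasurable (hA j) (by positivity) hK)
  rw [hid, norm_mul, norm_inv, norm_pow, Real.norm_of_nonneg hs.le]
  calc (s ^ n)⁻¹ * ‖∑ j, ∫ y in K, V j y * η j y‖
      ≤ (s ^ n)⁻¹ * ∑ _j : Fin n, 2 * C * ((A : ℝ) ^ (1 / p) * ((2 * s) ^ n * v) ^ (1 - 1 / p)) := by
        gcongr
        exact (norm_sum_le _ _).trans (Finset.sum_le_sum fun j _ => hbound j)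
    _ = morreyConst n p C A * s ^ (-(n / p)) := by
        rw [Finset.sum_const, Finset.card_univ, Fintype.card_fin, nsmul_eq_mul, morreyConst,
          mul_pow, mul_right_comm (2 ^ n) (s ^ n) v, Real.mul_rpow (by positivity) (by positivity)]
        have h1 : (s ^ n)⁻¹ * (s ^ n) ^ (1 - 1 / p) = s ^ (-(n / p)) := by
          rw [← Real.rpow_natCast, ← Real.rpow_neg hs.le, ← Real.rpow_mul hs.le,
            ← Real.rpow_add hs]
          congr 1; ring
        rw [← h1]; ring

/-- The bound `s ^ (-n/p)` on the scale derivative has the primitive `s ^ γ / γ` with `γ = 1 - n/p >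
0`. Comparing scales `ε` and `R` and letting `ε → 0`, where the averages tend to `U x`, gives the
estimate. -/
theorem norm_sub_integral_dilation_le {p : ℝ} (hnp : n < p) (hp : 1 < p) {K : Set E}
    (hKc : IsCompact K)
    {U : E → ℝ} {V : Fin n → E → ℝ} {A : ℝ≥0} (hV : ∀ j, IntegrableOn (V j) K)
    (hA : ∀ j, ∫⁻ y in K, ‖V j y‖ₑ ^ p ≤ A)
    (hU : ContinuousOn U K)
    (hweak : ∀ j, ∀ η : E → ℝ, ContDiff ℝ ∞ η → HasCompactSupport η → tsupport η ⊆ K →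
      ∫ y in K, U y * fderiv ℝ η y (EuclideanSpace.single j 1) = - ∫ y in K, V j y * η y)
    {κ : E → ℝ} (hκ : ContDiff ℝ ∞ κ) (hκs : tsupport κ ⊆ closedBall 0 2) {C : ℝ}
    (hC : ∀ w, ‖κ w‖ ≤ C) (hκ0 : ∀ w, 0 ≤ κ w) (hκ1 : ∫ w, κ w = 1)
    {x : E} {R : ℝ} (hR : 0 < R) (hK : closedBall x (2 * R) ⊆ K) :
    ‖(∫ y in K, U y * ((R ^ n)⁻¹ * κ (R⁻¹ • (y - x)))) - U x‖ ≤
      morreyConst n p C A * (R ^ (1 - n / p) / (1 - n / p)) := by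
  have hκc : HasCompactSupport κ :=
    (isCompact_closedBall (0 : E) 2).of_isClosed_subset (isClosed_tsupport κ) hκs
  have hUi : IntegrableOn U K := hU.integrableOn_compact hKc
  have hγ : 0 < 1 - n / p := by rw [sub_pos, div_lt_one (by linarith)]; exact hnp
  set γ := 1 - n / p with hγd
  have hM : 0 ≤ morreyConst n p C A := by
    have := (norm_nonneg _).trans (hC 0)
    unfold morreyConst; positivity
  set h : ℝ → ℝ := fun s => ∫ y in K, U y * ((s ^ n)⁻¹ * κ (s⁻¹ • (y - x))) with hh
  have hder : ∀ s, 0 < s → HasDerivAt h _ s := fun s hs =>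
    hasDerivAt_integral_mul_dilation (μ := volume.restrict K) hUi hκ hκc n x hs
  have hkey : ∀ ε, 0 < ε → ε ≤ R → ‖h R - h ε‖ ≤ morreyConst n p C A * (R ^ γ / γ) := by
    intro ε hε hεR
    have := image_norm_le_of_norm_deriv_right_le_deriv_boundary' (f := fun s => h s - h ε)
      (a := ε) (b := R) (B := fun s => morreyConst n p C A * (s ^ γ / γ))
      (B' := fun s => morreyConst n p C A * s ^ (-(n / p)))
      (fun s hs => ((hder s (hε.trans_le hs.1)).sub_const _).continuousAt.continuousWithinAt)
      (fun s hs => ((hder s (hε.trans_le hs.1)).sub_const _).hasDerivWithinAt)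
      (by rw [sub_self, norm_zero]; positivity)
      (by
        refine ContinuousOn.mul continuousOn_const (ContinuousOn.div_const ?_ _)
        exact continuousOn_id.rpow_const fun s hs => Or.inr hγ.le)
      (fun s hs => by
        have hs0 : s ≠ 0 := (hε.trans_le hs.1).ne'
        have h2 := (((Real.hasDerivAt_rpow_const (p := γ) (Or.inl hs0)).div_const γ).const_mul
          (morreyConst n p C A)).hasDerivWithinAt (s := Ici s)
        refine h2.congr_deriv ?_
        rw [mul_div_cancel_left₀ _ hγ.ne', hγd]
        congr 2; ring)
      (fun s hs => norm_deriv_integral_dilation_le hp hV hA hUi hweak hκ hκs hC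
        (hε.trans_le hs.1) ((closedBall_subset_closedBall (by linarith [hs.2])).trans hK))
    exact this ⟨hεR, le_rfl⟩
  have hlim : Tendsto h (𝓝[>] 0) (𝓝 (U x)) := by
    have hxK : K ∈ 𝓝 x := mem_of_superset (closedBall_mem_nhds x (by positivity)) hK
    have hxK' : x ∈ K := mem_of_mem_nhds hxK
    -- The approximate-identity theorem evaluates its kernel at multiples of `x - y` rather than `y
    -- - x`, hence the reflection.
    set κ' : E → ℝ := fun w => κ (-w) with hκ'
    have hm : MeasurableSet K := hKc.measurableSet
    have h1 := tendsto_integral_comp_smul_smul_of_integrable' (μ := (volume : Measure E))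
      (φ := κ') (g := indicator K U) (x₀ := x)
      (fun w => hκ0 _) (by simpa [κ'] using (integral_neg_eq_self κ volume).trans hκ1) ?_
      ((integrable_indicator_iff hm).2 hUi)
      ((hU.continuousAt hxK).congr (by
        filter_upwards [hxK] with y hy using (indicator_of_mem hy U).symm))
    · rw [indicator_of_mem hxK'] at h1
      refine (h1.comp tendsto_inv_nhdsGT_zero).congr fun s => ?_
      simp only [hh, Function.comp_apply]
      rw [← integral_indicator hm]
      congr 1 with y
      by_cases hy : y ∈ K
      · simp only [indicator_of_mem hy, κ', smul_eq_mul, finrank_euclideanSpace, Fintype.card_fin,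
          ← smul_neg, neg_sub, inv_pow]
        ring
      · simp [indicator_of_notMem hy]
    · have hc : ∀ᶠ w in Bornology.cobounded E, w ∉ closedBall (0 : E) 2 :=
        Bornology.isBounded_def.1 isBounded_closedBall
      refine tendsto_const_nhds.congr' ?_
      filter_upwards [hc] with w hw
      have : κ (-w) = 0 := by
        by_contra hne
        exact hw (by simpa using hκs (subset_tsupport κ hne))
      simp [κ', this]
  refine le_of_tendsto ((tendsto_const_nhds (x := h R)).sub hlim).norm ?_
  filter_upwards [Ioo_mem_nhdsGT hR] with ε hε using hkey ε hε.1 hε.2.le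

end Morrey

section MorreyOscillation

/-- Morrey's inequality: local oscillation estimate for continuous functions whose weak gradient
lies in `L^p`, `p > n`. -/
theorem exists_norm_sub_le_morreyConst (n : ℕ) {p : ℝ} (hnp : n < p) (hp : 1 < p) :
    ∃ C : ℝ, ∀ (U : EuclideanSpace ℝ (Fin n) → ℝ) (V : Fin n → EuclideanSpace ℝ (Fin n) → ℝ)
      (A : ℝ≥0) (b : EuclideanSpace ℝ (Fin n)) (R : ℝ), 0 < R →
      (∀ j, IntegrableOn (V j) (closedBall b (3 * R))) →
      (∀ j, ∫⁻ y in closedBall b (3 * R), ‖V j y‖ₑ ^ p ≤ A) →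
      ContinuousOn U (closedBall b (3 * R)) →
      (∀ j, ∀ η : EuclideanSpace ℝ (Fin n) → ℝ, ContDiff ℝ ∞ η → HasCompactSupport η →
        tsupport η ⊆ closedBall b (3 * R) →
        ∫ y in closedBall b (3 * R), U y * fderiv ℝ η y (EuclideanSpace.single j 1) =
          - ∫ y in closedBall b (3 * R), V j y * η y) →
      ∀ x ∈ closedBall b R,
        ‖U x - U b‖ ≤ 2 * (morreyConst n p C A * (R ^ (1 - n / p) / (1 - n / p))) := by
  set β : ContDiffBump (0 : EuclideanSpace ℝ (Fin n)) := ⟨1 / 2, 1, by norm_num, by norm_num⟩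
  set ρ := β.normed volume with hρ
  have hρs : tsupport ρ = closedBall 0 1 := β.tsupport_normed_eq
  obtain ⟨C, hC⟩ := (β.hasCompactSupport_normed (μ := volume)).exists_bound_of_continuous
    β.continuous_normed
  refine ⟨C, fun U V A b R hR hV hA hU hweak => ?_⟩
  have key : ∀ x ∈ closedBall b R,
      ‖(∫ y in closedBall b (3 * R), U y * ((R ^ n)⁻¹ * ρ (R⁻¹ • (y - b)))) - U x‖ ≤
        morreyConst n p C A * (R ^ (1 - n / p) / (1 - n / p)) := by
    intro x hx
    -- Shifting the bump by `c` turns the average centred at `b` into one seen from `x`, so a single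
    -- average serves every `x`. As `‖c‖ ≤ 1`, the shifted kernel is supported in radius `2`, and
    -- the ball of radius `2 * R` about `x` stays within `3 * R` of `b`.
    set c := R⁻¹ • (x - b) with hc
    have hc1 : ‖c‖ ≤ 1 := by
      rw [hc, norm_smul, norm_inv, Real.norm_of_nonneg hR.le, inv_mul_le_iff₀ hR, mul_one,
        ← dist_eq_norm]
      exact hx
    have hsm : ContDiff ℝ ∞ ρ := β.contDiff_normed
    have h := norm_sub_integral_dilation_le hnp hp (isCompact_closedBall b (3 * R)) hV hA hU hweak
      (κ := fun w => ρ (w + c)) (hsm.comp (contDiff_id.add contDiff_const))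
      (closure_minimal (fun w hw => by
        have h1 : w + c ∈ closedBall 0 1 := hρs ▸ subset_tsupport ρ hw
        rw [mem_closedBall_zero_iff] at h1 ⊢
        calc ‖w‖ = ‖(w + c) - c‖ := by simp
          _ ≤ ‖w + c‖ + ‖c‖ := norm_sub_le _ _
          _ ≤ 2 := by linarith) isClosed_closedBall)
      (fun w => hC _) (fun w => β.nonneg_normed _)
      ((integral_add_right_eq_self ρ c).trans β.integral_normed) hR (x := x)
      (closedBall_subset_closedBall' (by have := mem_closedBall.1 hx; linarith))
    have he : ∀ y, R⁻¹ • (y - x) + c = R⁻¹ • (y - b) := fun y => by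
      rw [hc, ← smul_add]; congr 1; abel
    simpa only [he] using h
  intro x hx
  have h1 := key x hx
  have h2 := key b (mem_closedBall_self hR.le)
  set I := ∫ y in closedBall b (3 * R), U y * ((R ^ n)⁻¹ * ρ (R⁻¹ • (y - b)))
  calc ‖U x - U b‖ = ‖(I - U b) - (I - U x)‖ := by congr 1; ring
    _ ≤ ‖I - U b‖ + ‖I - U x‖ := norm_sub_le _ _
    _ ≤ _ := by linarith

end MorreyOscillation

/-! ### Passage between `D` and the whole space; local equicontinuity. -/

section Subtype

variable {n : ℕ} {D : Set (EuclideanSpace ℝ (Fin n))}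

local notation "E" => EuclideanSpace ℝ (Fin n)

theorem setIntegral_extend_mul (hD : MeasurableSet D) {K : Set E}
    (hKD : K ⊆ D) (u : D → ℝ) {g : E → ℝ} (hg : ∀ y, y ∉ K → g y = 0) :
    ∫ y in K, Function.extend Subtype.val u 0 y * g y = ∫ x, u x * g x ∂(lebesgueOn D) := by
  rw [← setIntegral_eq_of_subset_of_forall_sdiff_eq_zero hD hKD
    fun y hy => by rw [hg y hy.2, mul_zero],
    lebesgueOn, ← integral_subtype_comap hD]
  simp

theorem integrableOn_extend (hD : MeasurableSet D) {K : Set E} (hK : IsCompact K) (hKD : K ⊆ D)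
    {v : D → ℝ} (hv : LocallyIntegrable v (lebesgueOn D)) :
    IntegrableOn (Function.extend Subtype.val v 0) K := by
  have hK' : IsCompact (Subtype.val ⁻¹' K : Set D) :=
    IsInducing.subtypeVal.isCompact_preimage_iff (by simpa using hKD) |>.2 hK
  rw [(MeasurableEmbedding.subtype_coe hD).integrableOn_iff_comap (by simpa using hKD),
    Function.extend_comp Subtype.val_injective]
  exact hv.integrableOn_isCompact hK'

theorem setLIntegral_extend (hD : MeasurableSet D) {K : Set E} (hKD : K ⊆ D) (v : D → ℝ)
    (F : ℝ → ℝ≥0∞) :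
    ∫⁻ y in K, F (Function.extend Subtype.val v 0 y) =
      ∫⁻ x in Subtype.val ⁻¹' K, F (v x) ∂(lebesgueOn D) := by
  have h := setLIntegral_subtype (μ := volume) hD (Subtype.val ⁻¹' K)
    (fun y => F (Function.extend Subtype.val v 0 y))
  rw [Subtype.image_preimage_coe, inter_eq_self_of_subset_right hKD] at h
  rw [← h, lebesgueOn]
  simp

theorem lebesgueOn_preimage (hD : MeasurableSet D) {K : Set E} (hKD : K ⊆ D) :
    lebesgueOn D (Subtype.val ⁻¹' K) = volume K := by
  rw [lebesgueOn, comap_subtype_coe_apply hD, Subtype.image_preimage_coe,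
    inter_eq_self_of_subset_right hKD]

variable {m : ℕ}

/-- A matrix as a vector of the Euclidean space of dimension `m * n`. -/
noncomputable def matrixVec (A : Matrix (Fin m) (Fin n) ℝ) : EuclideanSpace ℝ (Fin m × Fin n) :=
  WithLp.toLp 2 fun ij => A ij.1 ij.2

theorem norm_matrixVec (A : Matrix (Fin m) (Fin n) ℝ) : ‖matrixVec A‖ = gradModulus A := by
  simp [matrixVec, gradModulus, EuclideanSpace.norm_eq, Fintype.sum_prod_type]

theorem norm_entry_le_gradModulus (A : Matrix (Fin m) (Fin n) ℝ) (i : Fin m) (j : Fin n) :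
    ‖A i j‖ ≤ gradModulus A := by
  rw [← norm_matrixVec]
  exact PiLp.norm_apply_le (matrixVec A) (i, j)

theorem EuclideanSpace.norm_le_sum_norm (v : EuclideanSpace ℝ (Fin m)) : ‖v‖ ≤ ∑ i, ‖v i‖ := by
  conv_lhs => rw [← (EuclideanSpace.basisFun (Fin m) ℝ).sum_repr v]
  refine (norm_sum_le _ _).trans (le_of_eq ?_)
  simp [norm_smul]

/-- Morrey's inequality is applied to each component, extended by zero outside `D`. The power growth
of `φ` and the energy bound give an `L^p` bound common to the whole family, so one `δ` works for all
its members. -/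
theorem exists_dist_lt_of_mem_orliczSobolevFamily (hD : IsOpen D) {φ : ℝ≥0∞ → ℝ≥0∞} {p : ℝ}
    (hnp : n < p) (hp : 1 < p) {C : ℝ≥0} (hφ : ∀ t : ℝ≥0∞, t ≠ ⊤ → t ^ p ≤ C * (1 + φ t))
    (x₀ : D) (M : ℝ≥0) (b : D) {ε : ℝ} (hε : 0 < ε) :
    ∃ δ > 0, ∀ f ∈ orliczSobolevFamily m D x₀ φ M, ∀ y : D, dist y b < δ →
      dist (f y) (f b) < ε := by
  have hDm := hD.measurableSet
  obtain ⟨R₀, hR₀, hball⟩ := nhds_basis_closedBall.mem_iff.1 (hD.mem_nhds b.2)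
  obtain ⟨Cρ, hmorrey⟩ := exists_norm_sub_le_morreyConst n hnp hp
  -- This bound is taken on the fixed ball of radius `R₀`, so it does not change when `R` is chosen
  -- small afterwards.
  set A : ℝ≥0 := (C * (volume (closedBall (b : E) R₀) + M)).toNNReal with hA
  have hAtop : C * (volume (closedBall (b : E) R₀) + M) ≠ ⊤ :=
    ENNReal.mul_ne_top ENNReal.coe_ne_top
      (ENNReal.add_ne_top.2 ⟨measure_closedBall_lt_top.ne, ENNReal.coe_ne_top⟩)
  have hγ : 0 < 1 - n / p := by rw [sub_pos, div_lt_one (by linarith)]; exact hnp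
  set Φ : ℝ → ℝ := fun R => m * (2 * (morreyConst n p Cρ A * (R ^ (1 - n / p) / (1 - n / p))))
    with hΦ
  have hlim : Tendsto Φ (𝓝[>] 0) (𝓝 0) := by
    have h1 : Tendsto (fun R : ℝ => R ^ (1 - n / p)) (𝓝[>] 0) (𝓝 0) := by
      have := (Real.continuousAt_rpow_const 0 (1 - n / p) (Or.inr hγ.le)).tendsto
      rw [Real.zero_rpow hγ.ne'] at this
      exact this.mono_left nhdsWithin_le_nhds
    have h2 := (((h1.div_const (1 - n / p)).const_mul (morreyConst n p Cρ A)).const_mul 2).const_mul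
      (m : ℝ)
    simpa using h2
  obtain ⟨R, hRε, hR0, hRR⟩ : ∃ R, Φ R < ε ∧ 0 < R ∧ R < R₀ / 3 := by
    have h1 := (hlim.eventually (gt_mem_nhds hε)).and (Ioo_mem_nhdsGT (show 0 < R₀ / 3 by linarith))
    obtain ⟨R, h2, h3⟩ := h1.exists
    exact ⟨R, h2, h3.1, h3.2⟩
  refine ⟨R, hR0, fun f hf y hy => ?_⟩
  obtain ⟨hfc, -, G, hG, hM⟩ := hf
  have hKsub : closedBall (b : E) (3 * R) ⊆ closedBall (b : E) R₀ :=
    closedBall_subset_closedBall (by linarith)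
  have hKD : closedBall (b : E) (3 * R) ⊆ D := hKsub.trans hball
  have hKc : IsCompact (closedBall (b : E) (3 * R)) := isCompact_closedBall _ _
  have hLp : ∀ i j, ∫⁻ y in closedBall (b : E) (3 * R),
      ‖Function.extend Subtype.val (fun x => G x i j) 0 y‖ₑ ^ p ≤ A := fun i j => by
    rw [setLIntegral_extend hDm hKD _ (fun t => ‖t‖ₑ ^ p), hA, ENNReal.coe_toNNReal hAtop]
    calc ∫⁻ x in Subtype.val ⁻¹' closedBall (b : E) (3 * R), ‖G x i j‖ₑ ^ p ∂lebesgueOn D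
        ≤ ∫⁻ x in Subtype.val ⁻¹' closedBall (b : E) (3 * R),
          C * (1 + φ (ENNReal.ofReal (gradModulus (G x)))) ∂lebesgueOn D := by
          refine lintegral_mono fun x => ?_
          refine le_trans (ENNReal.rpow_le_rpow ?_ (by linarith)) (hφ _ ENNReal.ofReal_ne_top)
          rw [← ofReal_norm]
          exact ENNReal.ofReal_le_ofReal (norm_entry_le_gradModulus _ _ _)
      _ = C * (volume (closedBall (b : E) (3 * R)) +
          ∫⁻ x in Subtype.val ⁻¹' closedBall (b : E) (3 * R),
            φ (ENNReal.ofReal (gradModulus (G x))) ∂lebesgueOn D) := by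
          rw [lintegral_const_mul' _ _ ENNReal.coe_ne_top, lintegral_add_left measurable_const,
            setLIntegral_const, one_mul, lebesgueOn_preimage hDm hKD]
      _ ≤ C * (volume (closedBall (b : E) R₀) + M) := by
          gcongr
          exact (setLIntegral_le_lintegral _ _).trans hM
  have hcomp : ∀ i, ‖f y i - f b i‖ ≤
      2 * (morreyConst n p Cρ A * (R ^ (1 - n / p) / (1 - n / p))) := fun i => by
    have h := hmorrey (Function.extend Subtype.val (fun x => f x i) 0)
      (fun j => Function.extend Subtype.val (fun x => G x i j) 0) A b R hR0
      (fun j => integrableOn_extend hDm hKc hKD (hG i j).2.1) (hLp i)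
      (by
        rw [continuousOn_iff_continuous_domRestrict]
        have h1 : Continuous fun z : closedBall (b : E) (3 * R) => f ⟨z, hKD z.2⟩ i :=
          (EuclideanSpace.proj i).continuous.comp (hfc.comp (by fun_prop))
        refine h1.congr fun z => ?_
        exact (Subtype.val_injective.extend_apply (fun x : D => f x i) 0 ⟨z, hKD z.2⟩).symm)
      (fun j η hη hηc hηs => by
        rw [setIntegral_extend_mul hDm hKD, setIntegral_extend_mul hDm hKD]
        · exact (hG i j).2.2 η hη hηc (hηs.trans hKD)
        · intro y hy
          exact image_eq_zero_of_notMem_tsupport fun h => hy (hηs h)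
        · intro y hy
          have : y ∉ tsupport (fderiv ℝ η) := fun h => hy (hηs (tsupport_fderiv_subset ℝ h))
          rw [image_eq_zero_of_notMem_tsupport this]; rfl)
      y (mem_closedBall.2 hy.le)
    rwa [Subtype.val_injective.extend_apply, Subtype.val_injective.extend_apply] at h
  rw [dist_eq_norm]
  refine lt_of_le_of_lt (EuclideanSpace.norm_le_sum_norm _) (lt_of_le_of_lt ?_ hRε)
  refine (Finset.sum_le_sum fun i _ => (show ‖(f y - f b) i‖ ≤ _ from hcomp i)).trans ?_
  simp [hΦ]

end Subtype

/-! ### Normality of pointwise normalized equicontinuous families. -/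

section Normality

variable {X Y : Type*} [MetricSpace X] [MetricSpace Y]

/-- In a locally equicontinuous family on a connected space, boundedness at one point propagates to
all points. -/
theorem exists_dist_le_of_equicontinuous [PreconnectedSpace X] {F : Set (X → Y)} {x₀ : X} {y₀ : Y}
    (hx₀ : ∀ f ∈ F, f x₀ = y₀)
    (hF : ∀ b : X, ∀ ε > 0, ∃ δ > 0, ∀ f ∈ F, ∀ y, dist y b < δ → dist (f y) (f b) < ε) (x : X) :
    ∃ r, ∀ f ∈ F, dist (f x) y₀ ≤ r := by
  set B : Set X := {x | ∃ r, ∀ f ∈ F, dist (f x) y₀ ≤ r} with hB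
  have hclopen : IsClopen B := by
    constructor
    · refine isClosed_of_closure_subset fun b hb => ?_
      obtain ⟨δ, hδ, h⟩ := hF b 1 one_pos
      obtain ⟨y, ⟨r, hr⟩, hy⟩ := Metric.mem_closure_iff.1 hb δ hδ
      refine ⟨1 + r, fun f hf => (dist_triangle _ (f y) _).trans (add_le_add ?_ (hr f hf))⟩
      rw [dist_comm]
      exact (h f hf y (by rwa [dist_comm])).le
    · rw [Metric.isOpen_iff]
      rintro b ⟨r, hr⟩
      obtain ⟨δ, hδ, h⟩ := hF b 1 one_pos
      exact ⟨δ, hδ, fun y hy => ⟨1 + r, fun f hf =>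
        (dist_triangle _ (f b) _).trans (add_le_add (h f hf y hy).le (hr f hf))⟩⟩
  have hne : B.Nonempty := ⟨x₀, 0, fun f hf => by rw [hx₀ f hf, dist_self]⟩
  exact (hclopen.eq_univ hne ▸ mem_univ x : x ∈ B)

/-- Arzelà–Ascoli: a family of continuous maps that is equicontinuous and normalized at a point of
a connected locally compact space is normal. -/
theorem isNormalFamily_of_equicontinuous [PreconnectedSpace X] [LocallyCompactSpace X]
    [SecondCountableTopology X] [ProperSpace Y] {F : Set (X → Y)} {x₀ : X} {y₀ : Y}
    (hc : ∀ f ∈ F, Continuous f) (hx₀ : ∀ f ∈ F, f x₀ = y₀)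
    (hF : ∀ b : X, ∀ ε > 0, ∃ δ > 0, ∀ f ∈ F, ∀ y, dist y b < δ → dist (f y) (f b) < ε) :
    IsNormalFamily F := by
  intro f hf
  set S : Set C(X, Y) := {g | (g : X → Y) ∈ F} with hS
  have hcpt : IsCompact (closure S) := by
    have : T2Space (UniformOnFun X Y {K : Set X | IsCompact K}) :=
      UniformOnFun.t2Space_of_covering
        (sUnion_eq_univ_iff.2 fun x => ⟨{x}, isCompact_singleton, mem_singleton x⟩)
    refine ArzelaAscoli.isCompact_closure_of_isClosedEmbedding (𝔖 := {K : Set X | IsCompact K})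
      (F := fun g : C(X, Y) => (g : X → Y)) (fun K hK => hK)
      ContinuousMap.isUniformEmbedding_toUniformOnFunIsCompact.isClosedEmbedding ?_ ?_
    · intro K _
      refine Equicontinuous.equicontinuousOn ?_ K
      intro b
      rw [Metric.equicontinuousAt_iff]
      intro ε hε
      obtain ⟨δ, hδ, h⟩ := hF b ε hε
      exact ⟨δ, hδ, fun y hy g => by rw [dist_comm]; exact h _ g.2 y hy⟩
    · intro K _ x _
      obtain ⟨r, hr⟩ := exists_dist_le_of_equicontinuous hx₀ hF x
      exact ⟨closedBall y₀ r, isCompact_closedBall _ _, fun g hg => hr _ hg⟩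
  obtain ⟨g, -, s, hs, hlim⟩ := hcpt.tendsto_subseq
    (x := fun k => (⟨f k, hc _ (hf k)⟩ : C(X, Y))) (fun k => subset_closure (hf k))
  refine ⟨s, hs, g, g.continuous, fun C hC => ?_⟩
  exact ContinuousMap.tendsto_iff_forall_isCompact_tendstoUniformlyOn.1 hlim C hC

end Normality

/-! ### Strong convergence from midpoint convexity. -/

section Hilbert

variable {H : Type*} [NormedAddCommGroup H] [InnerProductSpace ℝ H] [CompleteSpace H]

/-- A decreasing sequence of nonempty midpoint-convex sets in a fixed ball of a Hilbert space admits
a strongly convergent selection. -/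
theorem exists_tendsto_selection_of_midpointConvex {S : ℕ → Set H} (hanti : Antitone S)
    (hne : ∀ k, (S k).Nonempty) (hmid : ∀ k, ∀ u ∈ S k, ∀ v ∈ S k, (2⁻¹ : ℝ) • (u + v) ∈ S k)
    {R : ℝ} (hR : ∀ k, ∀ u ∈ S k, ‖u‖ ≤ R) :
    ∃ (u : ℕ → H) (v : H), (∀ k, u k ∈ S k) ∧ Tendsto u atTop (𝓝 v) := by
  set d : ℕ → ℝ := fun k => sInf ((fun u => ‖u‖ ^ 2) '' S k) with hd
  have hbdd : ∀ k, BddBelow ((fun u => ‖u‖ ^ 2) '' S k) := fun k =>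
    ⟨0, by rintro _ ⟨u, -, rfl⟩; positivity⟩
  have hdle : ∀ k, ∀ u ∈ S k, d k ≤ ‖u‖ ^ 2 := fun k u hu => csInf_le (hbdd k) ⟨u, hu, rfl⟩
  have hmono : Monotone d := fun j k hjk =>
    csInf_le_csInf (hbdd j) ((hne k).image _) (image_mono (hanti hjk))
  have hbound : BddAbove (range d) := ⟨R ^ 2, by
    rintro _ ⟨k, rfl⟩
    obtain ⟨u, hu⟩ := hne k
    exact (hdle k u hu).trans (by gcongr; exact hR k u hu)⟩
  have hdlim := tendsto_atTop_ciSup hmono hbound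
  have hsel : ∀ k : ℕ, ∃ u ∈ S k, ‖u‖ ^ 2 < d k + 1 / (k + 1) := fun k => by
    obtain ⟨_, ⟨u, hu, rfl⟩, h⟩ := exists_lt_of_csInf_lt ((hne k).image fun u : H => ‖u‖ ^ 2)
      (show d k < d k + 1 / (k + 1) by have : (0 : ℝ) < 1 / (k + 1) := by positivity
                                       linarith)
    exact ⟨u, hu, h⟩
  choose u huS hu using hsel
  have hcauchy : CauchySeq u := by
    set D := ⨆ k, d k
    have hdD : ∀ k, d k ≤ D := fun k => le_ciSup hbound k
    -- The midpoint of `u j` and `u k` lies in `S k`, so its squared norm is at least `d k`. The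
    -- parallelogram law then controls the distance by the gap between `d k` and the limit of the
    -- infima, plus the selection errors.
    have key : ∀ k j, k ≤ j → ‖u j - u k‖ ^ 2 ≤ 4 * (D - d k) + 4 * (1 / (k + 1)) := by
      intro k j hkj
      have h1 := parallelogram_law_with_norm ℝ (u j) (u k)
      have h2 := hdle k _ (hmid k _ (hanti hkj (huS j)) _ (huS k))
      rw [norm_smul, mul_pow] at h2
      norm_num at h2
      have h3 := hu j
      have h4 := hu k
      have h5 := hdD j
      have h6 := hdD k
      have h7 : (1 : ℝ) / (j + 1) ≤ 1 / (k + 1) := by gcongr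
      nlinarith
    refine Metric.cauchySeq_iff'.2 fun ε hε => ?_
    have hlim : Tendsto (fun k : ℕ => 4 * (D - d k) + 4 * (1 / ((k : ℝ) + 1))) atTop (𝓝 0) := by
      have := ((tendsto_const_nhds (x := D)).sub hdlim).const_mul 4 |>.add
        (tendsto_one_div_add_atTop_nhds_zero_nat.const_mul (4 : ℝ))
      simpa using this
    obtain ⟨k, hk⟩ := (hlim.eventually (gt_mem_nhds (show 0 < ε ^ 2 by positivity))).exists
    refine ⟨k, fun j hj => ?_⟩
    rw [dist_eq_norm]
    exact lt_of_pow_lt_pow_left₀ 2 hε.le ((key k j hj).trans_lt hk)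
  obtain ⟨v, hv⟩ := cauchySeq_tendsto_of_complete hcauchy
  exact ⟨u, v, huS, hv⟩

end Hilbert

/-! ### Weak derivatives under midpoints and limits; an auxiliary finite measure. -/

section WeakDerivative

variable {n m : ℕ} {D : Set (EuclideanSpace ℝ (Fin n))}

theorem isLocallyFiniteMeasure_lebesgueOn (hD : IsOpen D) :
    IsLocallyFiniteMeasure (lebesgueOn D) := by
  refine ⟨fun x => ?_⟩
  obtain ⟨R, hR, hball⟩ := nhds_basis_closedBall.mem_iff.1 (hD.mem_nhds x.2)
  refine ⟨Subtype.val ⁻¹' closedBall (x : EuclideanSpace ℝ (Fin n)) R,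
    continuous_subtype_val.continuousAt.preimage_mem_nhds (closedBall_mem_nhds _ hR), ?_⟩
  rw [lebesgueOn_preimage hD.measurableSet hball]
  exact measure_closedBall_lt_top

theorem isCompact_preimage_tsupport {η : EuclideanSpace ℝ (Fin n) → ℝ} (hη : HasCompactSupport η)
    (hηD : tsupport η ⊆ D) : IsCompact (Subtype.val ⁻¹' tsupport η : Set D) :=
  IsInducing.subtypeVal.isCompact_preimage_iff (by simpa using hηD) |>.2 hη

theorem HasCompactSupport.comp_subtypeVal {η ζ : EuclideanSpace ℝ (Fin n) → ℝ}
    (hη : HasCompactSupport η) (hηD : tsupport η ⊆ D) (hζ : ∀ x, x ∉ tsupport η → ζ x = 0) :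
    HasCompactSupport fun x : D => ζ x :=
  HasCompactSupport.intro (isCompact_preimage_tsupport hη hηD) fun x hx => hζ x hx

theorem fderiv_apply_eq_zero_of_notMem_tsupport {E : Type*} [NormedAddCommGroup E]
    [NormedSpace ℝ E] {η : E → ℝ} (v : E) {x : E} (hx : x ∉ tsupport η) : fderiv ℝ η x v = 0 := by
  rw [image_eq_zero_of_notMem_tsupport fun h => hx (tsupport_fderiv_subset ℝ h)]
  rfl

theorem HasWeakPartialDeriv.midpoint {i : Fin n} {u v u' v' : D → ℝ}
    (h : HasWeakPartialDeriv D i u v) (h' : HasWeakPartialDeriv D i u' v') :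
    HasWeakPartialDeriv D i (fun x => 2⁻¹ * (u x + u' x)) (fun x => 2⁻¹ * (v x + v' x)) := by
  refine ⟨(h.1.add h'.1).smul (2⁻¹ : ℝ), (h.2.1.add h'.2.1).smul (2⁻¹ : ℝ),
    fun η hη hηc hηD => ?_⟩
  have hcD : Continuous fun x : D => fderiv ℝ η x (EuclideanSpace.single i 1) :=
    ((hη.continuous_fderiv (by simp)).clm_apply continuous_const).comp continuous_subtype_val
  have hsD := hηc.comp_subtypeVal hηD fun x hx =>
    fderiv_apply_eq_zero_of_notMem_tsupport (EuclideanSpace.single i 1) hx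
  have hc : Continuous fun x : D => η x := hη.continuous.comp continuous_subtype_val
  have hs := hηc.comp_subtypeVal hηD fun x hx => image_eq_zero_of_notMem_tsupport hx
  have key : ∀ {a b : D → ℝ} {g : D → ℝ}, LocallyIntegrable a (lebesgueOn D) →
      LocallyIntegrable b (lebesgueOn D) → Continuous g → HasCompactSupport g →
      ∫ x, 2⁻¹ * (a x + b x) * g x ∂(lebesgueOn D) =
        2⁻¹ * (∫ x, a x * g x ∂(lebesgueOn D) + ∫ x, b x * g x ∂(lebesgueOn D)) := by
    intro a b g ha hb hg hgs
    have hai : Integrable (fun x => a x * g x) (lebesgueOn D) :=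
      ha.integrable_smul_right_of_hasCompactSupport hg hgs
    have hbi : Integrable (fun x => b x * g x) (lebesgueOn D) :=
      hb.integrable_smul_right_of_hasCompactSupport hg hgs
    rw [← integral_add hai hbi, ← integral_const_mul]
    congr 1 with x
    ring
  rw [key h.1 h'.1 hcD hsD, key h.2.1 h'.2.1 hc hs, h.2.2 η hη hηc hηD, h'.2.2 η hη hηc hηD]
  ring

theorem IsWeakGradient.midpoint {f f' : D → EuclideanSpace ℝ (Fin m)}
    {G G' : D → Matrix (Fin m) (Fin n) ℝ} (h : IsWeakGradient D f G)
    (h' : IsWeakGradient D f' G') :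
    IsWeakGradient D (fun x => (2⁻¹ : ℝ) • (f x + f' x)) (fun x => (2⁻¹ : ℝ) • (G x + G' x)) :=
  fun i j => (h i j).midpoint (h' i j)

theorem IsWeakGradient.aestronglyMeasurable {f : D → EuclideanSpace ℝ (Fin m)}
    {G : D → Matrix (Fin m) (Fin n) ℝ} (hD : IsOpen D) (h : IsWeakGradient D f G) :
    AEStronglyMeasurable (fun x => matrixVec (G x)) (lebesgueOn D) := by
  have h1 : AEMeasurable (fun x (ij : Fin m × Fin n) => G x ij.1 ij.2) (lebesgueOn D) :=
    aemeasurable_pi_lambda _ fun ij => by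
      have : LocallyCompactSpace D := hD.locallyCompactSpace
      exact (h ij.1 ij.2).2.1.aestronglyMeasurable.aemeasurable
  exact ((WithLp.measurable_toLp 2 _).comp_aemeasurable h1).aestronglyMeasurable

/-- A limit of weak partial derivatives: if `u k → u` uniformly on compact sets and `v k → v` in
`L¹` on compact sets, then weak differentiability passes to the limit. -/
theorem HasWeakPartialDeriv.of_tendsto (hD : IsOpen D) {i : Fin n} {u v : ℕ → D → ℝ} {u₀ v₀ : D → ℝ}
    (h : ∀ k, HasWeakPartialDeriv D i (u k) (v k)) (hu₀ : Continuous u₀)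
    (hu : ∀ K : Set D, IsCompact K → TendstoUniformlyOn u u₀ atTop K)
    (hv₀ : LocallyIntegrable v₀ (lebesgueOn D))
    (hv : ∀ K : Set D, IsCompact K →
      Tendsto (fun k => eLpNorm (v k - v₀) 1 ((lebesgueOn D).restrict K)) atTop (𝓝 0)) :
    HasWeakPartialDeriv D i u₀ v₀ := by
  have := isLocallyFiniteMeasure_lebesgueOn hD
  have : LocallyCompactSpace D := hD.locallyCompactSpace
  have hu₀i : LocallyIntegrable u₀ (lebesgueOn D) := hu₀.locallyIntegrable
  refine ⟨hu₀i, hv₀, fun η hη hηc hηD => ?_⟩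
  set K : Set D := Subtype.val ⁻¹' tsupport η with hKdef
  have hK : IsCompact K := isCompact_preimage_tsupport hηc hηD
  have hcD : Continuous fun x : D => fderiv ℝ η x (EuclideanSpace.single i 1) :=
    ((hη.continuous_fderiv (by simp)).clm_apply continuous_const).comp continuous_subtype_val
  have hsD := hηc.comp_subtypeVal hηD fun x hx =>
    fderiv_apply_eq_zero_of_notMem_tsupport (EuclideanSpace.single i 1) hx
  have hc : Continuous fun x : D => η x := hη.continuous.comp continuous_subtype_val
  have key : ∀ {a : ℕ → D → ℝ} {a₀ g : D → ℝ}, (∀ k, LocallyIntegrable (a k) (lebesgueOn D)) →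
      LocallyIntegrable a₀ (lebesgueOn D) → Continuous g → (∀ x, x ∉ K → g x = 0) →
      Tendsto (fun k => eLpNorm (a k - a₀) 1 ((lebesgueOn D).restrict K)) atTop (𝓝 0) →
      Tendsto (fun k => ∫ x, a k x * g x ∂(lebesgueOn D)) atTop
        (𝓝 (∫ x, a₀ x * g x ∂(lebesgueOn D))) := by
    intro a a₀ g ha ha₀ hg hgK hlim
    have hgs : HasCompactSupport g := HasCompactSupport.intro hK hgK
    obtain ⟨B, hB⟩ := hgs.exists_bound_of_continuous hg
    have hrestr : ∀ b : D → ℝ, ∫ x, b x * g x ∂(lebesgueOn D) =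
        ∫ x in K, b x * g x ∂(lebesgueOn D) := fun b =>
      (setIntegral_eq_integral_of_forall_compl_eq_zero fun x hx => by rw [hgK x hx, mul_zero]).symm
    simp only [hrestr]
    refine tendsto_integral_of_L1' _
      (ha₀.integrable_smul_right_of_hasCompactSupport hg hgs).integrableOn.aestronglyMeasurable
      (Eventually.of_forall fun k =>
        ((ha k).integrable_smul_right_of_hasCompactSupport hg hgs).integrableOn) ?_
    have hle : ∀ k, eLpNorm ((fun x => a k x * g x) - fun x => a₀ x * g x) 1
        ((lebesgueOn D).restrict K) ≤
        ENNReal.ofReal B * eLpNorm (a k - a₀) 1 ((lebesgueOn D).restrict K) := fun k => by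
      refine eLpNorm_le_mul_eLpNorm_of_ae_le_mul (ae_of_all _ fun x => ?_) 1
      rw [Pi.sub_apply, Pi.sub_apply, ← sub_mul, norm_mul, mul_comm]
      exact mul_le_mul_of_nonneg_right (hB x) (norm_nonneg _)
    refine tendsto_of_tendsto_of_tendsto_of_le_of_le tendsto_const_nhds ?_ (fun _ => bot_le) hle
    simpa using ENNReal.Tendsto.const_mul hlim (Or.inr ENNReal.ofReal_ne_top)
  have huL : Tendsto (fun k => eLpNorm (u k - u₀) 1 ((lebesgueOn D).restrict K)) atTop (𝓝 0) := by
    have hμK : (lebesgueOn D) K ≠ ⊤ := hK.measure_lt_top.ne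
    rw [ENNReal.tendsto_nhds_zero]
    intro ε hε
    obtain ⟨δ, hδ, hδε⟩ : ∃ δ : ℝ≥0, 0 < δ ∧ (δ : ℝ≥0∞) * (lebesgueOn D) K ≤ ε := by
      obtain ⟨δ, hδ, h⟩ := ENNReal.exists_nnreal_pos_mul_lt hμK hε.ne'
      exact ⟨δ, hδ, h.le⟩
    have h1 := Metric.tendstoUniformlyOn_iff.1 (hu K hK) δ (by exact_mod_cast hδ)
    filter_upwards [h1] with k hk
    refine (eLpNorm_le_of_ae_bound (C := δ) ?_).trans ?_
    · refine (ae_restrict_iff' hK.measurableSet).2 (ae_of_all _ fun x hx => ?_)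
      have := hk x hx
      rw [dist_comm, dist_eq_norm] at this
      exact this.le
    · simpa [mul_comm] using hδε
  have h1 := key (fun k => (h k).1) hu₀i hcD
    (fun x hx => fderiv_apply_eq_zero_of_notMem_tsupport _ hx) huL
  have h2 := key (fun k => (h k).2.1) hv₀ hc
    (fun x hx => image_eq_zero_of_notMem_tsupport hx) (hv K hK)
  refine tendsto_nhds_unique h1 ?_
  refine h2.neg.congr fun k => ?_
  exact ((h k).2.2 η hη hηc hηD).symm

/-- Lebesgue measure on an open set dominates a finite measure that is comparable with it on
compact sets. -/
theorem exists_finite_measure_le_lebesgueOn (hD : IsOpen D) :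
    ∃ ν : Measure D, IsFiniteMeasure ν ∧ ν ≤ lebesgueOn D ∧ lebesgueOn D ≪ ν ∧
      ∀ K : Set D, IsCompact K → ∃ c : ℝ≥0, (lebesgueOn D).restrict K ≤ c • ν := by
  -- The decay exponent exceeds the dimension, so `w` is integrable. Moreover `w ≤ 1`, and `w` is
  -- bounded below on compact sets by continuity and positivity.
  set w : EuclideanSpace ℝ (Fin n) → ℝ := fun x => (1 + ‖x‖) ^ (-((n : ℝ) + 1)) with hw
  have hwpos : ∀ x, 0 < w x := fun x => by positivity
  have hwc : Continuous w := by
    refine Continuous.rpow_const (by fun_prop) fun x => Or.inl (by positivity)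
  have hwi : Integrable w := integrable_one_add_norm (by simp)
  set W : D → ℝ≥0∞ := fun x => ENNReal.ofReal (w x) with hW
  have hWm : Measurable W := by
    exact (ENNReal.continuous_ofReal.comp (hwc.comp continuous_subtype_val)).measurable
  refine ⟨(lebesgueOn D).withDensity W, ?_, ?_, ?_, ?_⟩
  · refine isFiniteMeasure_withDensity ?_
    rw [lebesgueOn, lintegral_subtype_comap hD.measurableSet (fun x => ENNReal.ofReal (w x))]
    exact ((setLIntegral_le_lintegral _ _).trans_lt hwi.lintegral_lt_top).ne
  · calc (lebesgueOn D).withDensity W ≤ (lebesgueOn D).withDensity 1 := by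
          refine withDensity_mono (ae_of_all _ fun x => ?_)
          refine ENNReal.ofReal_le_one.2 (Real.rpow_le_one_of_one_le_of_nonpos ?_ ?_)
          · have := norm_nonneg (x : EuclideanSpace ℝ (Fin n)); linarith
          · linarith [(Nat.cast_nonneg n : (0 : ℝ) ≤ n)]
      _ = lebesgueOn D := withDensity_one
  · exact withDensity_absolutelyContinuous' hWm.aemeasurable
      (ae_of_all _ fun x => by simpa [hW] using hwpos x)
  · intro K hK
    have hinv : Continuous fun x : D => (w x)⁻¹ :=
      (hwc.comp continuous_subtype_val).inv₀ fun x : D => (hwpos (x : _)).ne'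
    obtain ⟨c, hc⟩ := hK.exists_bound_of_continuousOn hinv.continuousOn
    refine ⟨c.toNNReal, Measure.le_iff.2 fun s hs => ?_⟩
    rw [Measure.restrict_apply hs, Measure.smul_apply, withDensity_apply _ hs]
    calc (lebesgueOn D) (s ∩ K) = ∫⁻ _ in s ∩ K, 1 ∂(lebesgueOn D) := by simp
      _ ≤ ∫⁻ x in s ∩ K, c.toNNReal * W x ∂(lebesgueOn D) := by
        refine setLIntegral_mono' (hs.inter hK.measurableSet) fun x hx => ?_
        have h1 := hc x hx.2
        rw [Real.norm_of_nonneg (inv_nonneg.2 (hwpos x).le), inv_le_iff_one_le_mul₀ (hwpos x)] at h1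
        rw [hW, ← ENNReal.ofReal, ← ENNReal.ofReal_mul' (hwpos x).le]
        simpa using h1
      _ = c.toNNReal * ∫⁻ x in s ∩ K, W x ∂(lebesgueOn D) :=
        lintegral_const_mul (μ := (lebesgueOn D).restrict (s ∩ K)) (c.toNNReal : ℝ≥0∞) hWm
      _ ≤ c.toNNReal • ∫⁻ x in s, W x ∂(lebesgueOn D) := by
        rw [ENNReal.smul_def, smul_eq_mul]
        gcongr
        exact inter_subset_left

end WeakDerivative

/-! ### Closedness under uniform convergence on compact sets. -/

section Closedness

variable {n m : ℕ} {D : Set (EuclideanSpace ℝ (Fin n))}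

theorem matrixVec_midpoint (A B : Matrix (Fin m) (Fin n) ℝ) :
    matrixVec ((2⁻¹ : ℝ) • (A + B)) = (2⁻¹ : ℝ) • (matrixVec A + matrixVec B) := rfl

theorem map_gradModulus_midpoint_le {φ : ℝ≥0∞ → ℝ≥0∞} (hφ : Monotone φ)
    (hconv : ConvexOn ℝ≥0 univ φ) (A B : Matrix (Fin m) (Fin n) ℝ) :
    φ (ENNReal.ofReal (gradModulus ((2⁻¹ : ℝ) • (A + B)))) ≤
      2⁻¹ * (φ (ENNReal.ofReal (gradModulus A)) + φ (ENNReal.ofReal (gradModulus B))) := by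
  have h2 : ((2⁻¹ : ℝ≥0) : ℝ≥0∞) = 2⁻¹ := by simp
  have hle : ENNReal.ofReal (gradModulus ((2⁻¹ : ℝ) • (A + B))) ≤
      (2⁻¹ : ℝ≥0) • ENNReal.ofReal (gradModulus A) +
        (2⁻¹ : ℝ≥0) • ENNReal.ofReal (gradModulus B) := by
    simp only [← norm_matrixVec, matrixVec_midpoint, ofReal_norm, enorm_smul, ENNReal.smul_def,
      smul_eq_mul, h2, ← mul_add]
    have : ‖(2⁻¹ : ℝ)‖ₑ = 2⁻¹ := by simp [← ofReal_norm, ENNReal.ofReal_inv_of_pos]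
    rw [this]
    gcongr
    exact enorm_add_le _ _
  refine (hφ hle).trans ((hconv.2 (mem_univ _) (mem_univ _) bot_le bot_le ?_).trans (le_of_eq ?_))
  · rw [← two_mul]; exact mul_inv_cancel₀ two_ne_zero
  · simp only [ENNReal.smul_def, smul_eq_mul, h2, mul_add]

theorem lintegral_gradModulus_midpoint_le {φ : ℝ≥0∞ → ℝ≥0∞} (hφc : Continuous φ)
    (hφ : Monotone φ) (hconv : ConvexOn ℝ≥0 univ φ) {μ : Measure D} {M : ℝ≥0}
    {G G' : D → Matrix (Fin m) (Fin n) ℝ}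
    (hGm : AEStronglyMeasurable (fun x => matrixVec (G x)) μ)
    (hG : ∫⁻ x, φ (ENNReal.ofReal (gradModulus (G x))) ∂μ ≤ M)
    (hG' : ∫⁻ x, φ (ENNReal.ofReal (gradModulus (G' x))) ∂μ ≤ M) :
    ∫⁻ x, φ (ENNReal.ofReal (gradModulus ((2⁻¹ : ℝ) • (G x + G' x)))) ∂μ ≤ M := by
  have hm : AEMeasurable (fun x => φ (ENNReal.ofReal (gradModulus (G x)))) μ := by
    simp only [← norm_matrixVec, ofReal_norm]
    exact hφc.measurable.comp_aemeasurable hGm.enorm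
  calc _ ≤ ∫⁻ x, 2⁻¹ * (φ (ENNReal.ofReal (gradModulus (G x))) +
        φ (ENNReal.ofReal (gradModulus (G' x)))) ∂μ :=
        lintegral_mono fun x => map_gradModulus_midpoint_le hφ hconv _ _
    _ = 2⁻¹ * (∫⁻ x, φ (ENNReal.ofReal (gradModulus (G x))) ∂μ +
        ∫⁻ x, φ (ENNReal.ofReal (gradModulus (G' x))) ∂μ) := by
        rw [lintegral_const_mul' _ _ (by simp), lintegral_add_left' hm]
    _ ≤ 2⁻¹ * (M + M) := by gcongr
    _ = M := by
        rw [← two_mul, ← mul_assoc, ENNReal.inv_mul_cancel two_ne_zero ENNReal.ofNat_ne_top,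
          one_mul]

/-- Quadratic growth is all that is needed here: it places the gradients in one ball of the Hilbert
space `L²(ν)`. The approximants need not be members of the original sequence, nor vanish at `x₀`;
closeness to `g`, the gradient and the energy bound suffice. -/
theorem isClosedFamily_orliczSobolevFamily (hD : IsOpen D) {φ : ℝ≥0∞ → ℝ≥0∞} (hφc : Continuous φ)
    (hφm : Monotone φ) (hconv : ConvexOn ℝ≥0 univ φ) {C : ℝ≥0}
    (hφ : ∀ t : ℝ≥0∞, t ≠ ⊤ → t ^ (2 : ℝ) ≤ C * (1 + φ t)) (x₀ : D) (M : ℝ≥0) :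
    IsClosedFamily (orliczSobolevFamily m D x₀ φ M) := by
  intro f g hf hfg
  have : LocallyCompactSpace D := hD.locallyCompactSpace
  have hgc : Continuous g := by
    refine TendstoLocallyUniformly.continuous (p := atTop) (F := f)
      (tendstoLocallyUniformly_iff_forall_isCompact.2 hfg)
      (Frequently.of_forall fun k => (hf k).1)
  have hg0 : g x₀ = 0 := by
    have h1 := (hfg {x₀} isCompact_singleton).tendsto_at (mem_singleton x₀)
    exact tendsto_nhds_unique h1 (tendsto_const_nhds.congr fun k => (hf k).2.1.symm)
  obtain ⟨ν, hνfin, hνle, hac, hνK⟩ := exists_finite_measure_le_lebesgueOn hD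
  -- `T k` consists of maps at least as close to `g` as the tail `f k, f (k + 1), …`.
  set T : ℕ → Set (D → EuclideanSpace ℝ (Fin m)) := fun k =>
    {u | ∀ K : Set D, IsCompact K → ∀ ε : ℝ, (∀ j ≥ k, ∀ x ∈ K, ‖f j x - g x‖ ≤ ε) →
      ∀ x ∈ K, ‖u x - g x‖ ≤ ε} with hT
  set S : ℕ → Set (Lp (EuclideanSpace ℝ (Fin m × Fin n)) 2 ν) := fun k =>
    {h | ∃ u ∈ T k, ∃ G : D → Matrix (Fin m) (Fin n) ℝ, IsWeakGradient D u G ∧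
      ∫⁻ x, φ (ENNReal.ofReal (gradModulus (G x))) ∂(lebesgueOn D) ≤ M ∧
      h =ᵐ[ν] fun x => matrixVec (G x)} with hS
  have hL2 : ∀ G : D → Matrix (Fin m) (Fin n) ℝ,
      ∫⁻ x, φ (ENNReal.ofReal (gradModulus (G x))) ∂(lebesgueOn D) ≤ M →
      eLpNorm (fun x => matrixVec (G x)) 2 ν ≤ (C * (ν univ + M)) ^ (1 / 2 : ℝ) := by
    intro G hG
    rw [eLpNorm_eq_lintegral_rpow_enorm_toReal two_ne_zero ENNReal.ofNat_ne_top]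
    simp only [ENNReal.toReal_ofNat]
    gcongr
    calc ∫⁻ x, ‖matrixVec (G x)‖ₑ ^ (2 : ℝ) ∂ν
        ≤ ∫⁻ x, C * (1 + φ (ENNReal.ofReal (gradModulus (G x)))) ∂ν := by
          refine lintegral_mono fun x => ?_
          rw [← norm_matrixVec, ofReal_norm]
          exact hφ _ enorm_ne_top
      _ = C * (ν univ + ∫⁻ x, φ (ENNReal.ofReal (gradModulus (G x))) ∂ν) := by
          rw [lintegral_const_mul' _ _ ENNReal.coe_ne_top, lintegral_add_left measurable_const,
            lintegral_const, one_mul]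
      _ ≤ C * (ν univ + M) := by
          gcongr
          exact (lintegral_mono' hνle le_rfl).trans hG
  have hRtop : ((C : ℝ≥0∞) * (ν univ + M)) ^ (1 / 2 : ℝ) ≠ ⊤ :=
    (ENNReal.rpow_lt_top_of_nonneg (by norm_num) (ENNReal.mul_ne_top ENNReal.coe_ne_top
      (ENNReal.add_ne_top.2 ⟨measure_ne_top ν _, ENNReal.coe_ne_top⟩))).ne
  have hmono : ∀ {j k}, j ≤ k → T k ⊆ T j := fun hjk u hu K hK ε h =>
    hu K hK ε fun i hi => h i (hjk.trans hi)
  have hanti : Antitone S := fun j k hjk h ⟨u, hu, G, hG⟩ => ⟨u, hmono hjk hu, G, hG⟩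
  have hne : ∀ k, (S k).Nonempty := fun k => by
    obtain ⟨-, -, G, hG, hGM⟩ := hf k
    have hmem : MemLp (fun x => matrixVec (G x)) 2 ν :=
      ⟨(hG.aestronglyMeasurable hD).mono_measure hνle, (hL2 G hGM).trans_lt hRtop.lt_top⟩
    exact ⟨hmem.toLp _, f k, fun K hK ε h => h k le_rfl, G, hG, hGM, hmem.coeFn_toLp⟩
  have hmid : ∀ k, ∀ h ∈ S k, ∀ h' ∈ S k, (2⁻¹ : ℝ) • (h + h') ∈ S k := by
    rintro k h ⟨u, hu, G, hG, hGM, hh⟩ h' ⟨u', hu', G', hG', hGM', hh'⟩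
    refine ⟨_, ?_, _, hG.midpoint hG',
      lintegral_gradModulus_midpoint_le hφc hφm hconv (hG.aestronglyMeasurable hD) hGM hGM', ?_⟩
    · intro K hK ε hε x hx
      have h1 := hu K hK ε hε x hx
      have h2 := hu' K hK ε hε x hx
      have h3 : (2⁻¹ : ℝ) • (u x + u' x) - g x = (2⁻¹ : ℝ) • ((u x - g x) + (u' x - g x)) := by
        module
      rw [h3, norm_smul, norm_inv, Real.norm_ofNat]
      have := norm_add_le (u x - g x) (u' x - g x)
      linarith
    · filter_upwards [Lp.coeFn_smul (2⁻¹ : ℝ) (h + h'), Lp.coeFn_add h h', hh, hh'] with x h1 h2 h3 h4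
      rw [h1, Pi.smul_apply, h2, Pi.add_apply, h3, h4, matrixVec_midpoint]
  have hbd : ∀ k, ∀ h ∈ S k, ‖h‖ ≤ (((C : ℝ≥0∞) * (ν univ + M)) ^ (1 / 2 : ℝ)).toReal := by
    rintro k h ⟨u, -, G, -, hGM, hh⟩
    rw [Lp.norm_def, eLpNorm_congr_ae hh]
    exact ENNReal.toReal_mono hRtop (hL2 G hGM)
  obtain ⟨h, h₀, hhS, hlim⟩ := exists_tendsto_selection_of_midpointConvex hanti hne hmid hbd
  choose u huT G hG hGM hhG using hhS
  have hlim2 : Tendsto (fun k => eLpNorm (⇑(h k) - ⇑h₀) 2 ν) atTop (𝓝 0) :=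
    (Lp.tendsto_Lp_iff_tendsto_eLpNorm' _ _).1 hlim
  refine ⟨hgc, hg0, fun x i j => h₀ x (i, j), fun i j => ?_, ?_⟩
  · have hentry : MemLp (fun x => h₀ x (i, j)) 2 ν :=
      (Lp.memLp h₀).continuousLinearMap_comp
        (EuclideanSpace.proj (i, j) : EuclideanSpace ℝ (Fin m × Fin n) →L[ℝ] ℝ)
    refine HasWeakPartialDeriv.of_tendsto hD (fun k => hG k i j)
      ((EuclideanSpace.proj i : EuclideanSpace ℝ (Fin m) →L[ℝ] ℝ).continuous.comp hgc) ?_ ?_ ?_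
    · intro K hK
      rw [Metric.tendstoUniformlyOn_iff]
      intro ε hε
      obtain ⟨k₀, hk₀⟩ := eventually_atTop.1 (Metric.tendstoUniformlyOn_iff.1 (hfg K hK) (ε / 2)
        (by positivity))
      filter_upwards [eventually_ge_atTop k₀] with k hk x hx
      have h1 := huT k K hK (ε / 2) (fun j hj x hx => by
        have := hk₀ j (hk.trans hj) x hx
        rw [dist_comm, dist_eq_norm] at this
        exact this.le) x hx
      rw [dist_comm, dist_eq_norm]
      have h2 : ‖(u k x - g x) i‖ ≤ ‖u k x - g x‖ := PiLp.norm_apply_le _ i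
      calc ‖u k x i - g x i‖ ≤ ‖u k x - g x‖ := h2
        _ < ε := by linarith
    · rw [locallyIntegrable_iff]
      intro K hK
      obtain ⟨c, hc⟩ := hνK K hK
      exact ((hentry.integrable (by norm_num)).smul_measure_nnreal (c := c)).mono_measure hc
    · intro K hK
      obtain ⟨c, hc⟩ := hνK K hK
      -- On a compact set Lebesgue measure is at most `c • ν`, and the finite mass of `ν` turns
      -- `L²(ν)` convergence into `L¹` convergence.
      have hle : ∀ k, eLpNorm ((fun x => G k x i j) - fun x => h₀ x (i, j)) 1
          ((lebesgueOn D).restrict K) ≤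
          c * (eLpNorm (⇑(h k) - ⇑h₀) 2 ν * ν univ ^ (1 / 2 : ℝ)) := fun k => by
        calc _ ≤ eLpNorm ((fun x => G k x i j) - fun x => h₀ x (i, j)) 1 (c • ν) :=
              eLpNorm_mono_measure _ hc
          _ = c * eLpNorm ((fun x => G k x i j) - fun x => h₀ x (i, j)) 1 ν :=
              eLpNorm_one_smul_measure (c : ℝ≥0∞)
          _ ≤ c * eLpNorm (⇑(h k) - ⇑h₀) 1 ν := by
              gcongr
              refine eLpNorm_mono_ae ?_
              simp only [Pi.sub_apply]
              filter_upwards [hhG k] with x hx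
              have := PiLp.norm_apply_le ((⇑(h k) - ⇑h₀) x) (i, j)
              rw [Pi.sub_apply, hx] at this
              rw [hx]
              exact this
          _ ≤ _ := by
              gcongr
              have h1 := eLpNorm_le_eLpNorm_mul_rpow_measure_univ (μ := ν) (p := 1) (q := 2)
                (by norm_num) ((Lp.aestronglyMeasurable (h k)).sub (Lp.aestronglyMeasurable h₀))
              norm_num at h1 ⊢
              exact h1
      refine tendsto_of_tendsto_of_tendsto_of_le_of_le tendsto_const_nhds ?_ (fun _ => bot_le) hle
      have h1 := ENNReal.Tendsto.const_mul (a := (c : ℝ≥0∞)) (ENNReal.Tendsto.mul_const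
        (b := ν univ ^ (1 / 2 : ℝ)) hlim2 (Or.inr
        (ENNReal.rpow_lt_top_of_nonneg (by norm_num) (measure_ne_top ν _)).ne))
        (Or.inr ENNReal.coe_ne_top)
      simpa using h1
  -- A subsequence converges almost everywhere for `ν`, hence for Lebesgue measure by absolute
  -- continuity. Continuity of `φ` and Fatou's lemma then carry the energy bound to the limit.
  · obtain ⟨ns, -, hns⟩ := (tendstoInMeasure_of_tendsto_Lp hlim).exists_seq_tendsto_ae
    set Ψ : EuclideanSpace ℝ (Fin m × Fin n) → ℝ≥0∞ := fun v => φ ‖v‖ₑ with hΨ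
    have hΨc : Continuous Ψ := hφc.comp continuous_enorm
    have hΨG : ∀ A : Matrix (Fin m) (Fin n) ℝ,
        φ (ENNReal.ofReal (gradModulus A)) = Ψ (matrixVec A) := fun A => by
      rw [← norm_matrixVec, ofReal_norm]
    simp only [hΨG] at hGM
    calc _ = ∫⁻ x, Ψ (h₀ x) ∂(lebesgueOn D) :=
          lintegral_congr fun x => hΨG fun i j => h₀ x (i, j)
      _ = ∫⁻ x, liminf (fun k => Ψ (matrixVec (G (ns k) x))) atTop ∂(lebesgueOn D) := by
          refine lintegral_congr_ae ?_
          filter_upwards [hac.ae_le hns, hac.ae_le (ae_all_iff.2 hhG)] with x hx hx'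
          have h1 := (hΨc.tendsto _).comp hx
          refine (h1.congr fun k => ?_).liminf_eq.symm
          rw [Function.comp_apply, hx']
      _ ≤ liminf (fun k => ∫⁻ x, Ψ (matrixVec (G (ns k) x)) ∂(lebesgueOn D)) atTop :=
          lintegral_liminf_le' fun k =>
            hΨc.measurable.comp_aemeasurable ((hG (ns k)).aestronglyMeasurable hD).aemeasurable
      _ ≤ M := liminf_le_of_le (by isBoundedDefault) fun b hb => by
          obtain ⟨k, hk⟩ := hb.exists
          exact hk.trans (hGM _)

end Closedness

/-! ### Assembly. -/

section Main

variable {n m : ℕ} {D : Set (EuclideanSpace ℝ (Fin n))}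

/-- Compactness of the family under power growth of `φ` with an exponent above the dimension. -/
theorem isCompactFamily_orliczSobolevFamily (hn : 2 ≤ n) (hD : IsOpen D) (hDc : IsConnected D)
    {φ : ℝ≥0∞ → ℝ≥0∞} (hφc : Continuous φ) (hφm : Monotone φ) (hconv : ConvexOn ℝ≥0 univ φ)
    {p : ℝ} (hnp : n < p) {C : ℝ≥0} (hφ : ∀ t : ℝ≥0∞, t ≠ ⊤ → t ^ p ≤ C * (1 + φ t))
    (x₀ : D) (M : ℝ≥0) : IsCompactFamily (orliczSobolevFamily m D x₀ φ M) := by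
  have hn2 : (2 : ℝ) ≤ n := by exact_mod_cast hn
  have : LocallyCompactSpace D := hD.locallyCompactSpace
  have : PreconnectedSpace D := Subtype.preconnectedSpace hDc.isPreconnected
  refine ⟨fun f hf => hf.1, ?_, ?_⟩
  · exact isNormalFamily_of_equicontinuous (fun f hf => hf.1) (fun f hf => hf.2.1)
      fun b ε hε => exists_dist_lt_of_mem_orliczSobolevFamily hD hnp (by linarith) hφ x₀ M b hε
  -- Since `p > n ≥ 2`, growth of order `p` implies quadratic growth for `t ≥ 1`; the extra `1` in
  -- the constant covers `t ≤ 1`.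
  · refine isClosedFamily_orliczSobolevFamily hD hφc hφm hconv (C := 1 + C) (fun t ht => ?_) x₀ M
    rcases le_total t 1 with h | h
    · calc t ^ (2 : ℝ) ≤ 1 := ENNReal.rpow_le_one h (by norm_num)
        _ ≤ ((1 + C : ℝ≥0) : ℝ≥0∞) * (1 + φ t) := by
          rw [ENNReal.coe_add, ENNReal.coe_one]
          exact one_le_mul le_self_add le_self_add
    · calc t ^ (2 : ℝ) ≤ t ^ p := ENNReal.rpow_le_rpow_of_exponent_le h (by linarith)
        _ ≤ C * (1 + φ t) := hφ t ht
        _ ≤ ((1 + C : ℝ≥0) : ℝ≥0∞) * (1 + φ t) := by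
          rw [ENNReal.coe_add]
          gcongr
          exact le_add_self

theorem isCompactFamily_of_lintegral_lt_top (hn : 2 ≤ n) (hD : IsOpen D) (hDc : IsConnected D)
    {φ : ℝ≥0∞ → ℝ≥0∞} (hφc : Continuous φ) (hφm : Monotone φ) (hconv : ConvexOn ℝ≥0 univ φ)
    {a α : ℝ} (ha : zeroThreshold φ < ENNReal.ofReal a) (hα : 0 < α) (hαn : α < 1 / ((n : ℝ) - 1))
    (hint : ∫⁻ t in Ioi a, (ENNReal.ofReal t / φ (ENNReal.ofReal t)) ^ α < ⊤)
    (x₀ : D) (M : ℝ≥0) : IsCompactFamily (orliczSobolevFamily m D x₀ φ M) := by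
  have hn2 : (2 : ℝ) ≤ n := by exact_mod_cast hn
  have ha0 : 0 < a := ENNReal.ofReal_pos.1 (bot_le.trans_lt ha)
  have hpos : φ (ENNReal.ofReal a) ≠ 0 := fun h => (le_sSup (show _ ∈ {t | φ t = 0} from h)).not_gt ha
  obtain ⟨C, hC⟩ := rpow_le_of_lintegral_div_rpow_lt_top hφm ha0 hα hpos hint
  refine isCompactFamily_orliczSobolevFamily hn hD hDc hφc hφm hconv (p := 1 + 1 / α) ?_ hC x₀ M
  have := (lt_one_div hα (by linarith)).1 hαn
  linarith

end Main

theorem mainTheorem1 (n m : ℕ) (hn : 2 ≤ n) (hm : 1 ≤ m)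
    (D : Set (EuclideanSpace ℝ (Fin n))) (hD_open : IsOpen D) (hD_conn : IsConnected D)
    (x₀ : D) (M : ℝ≥0) :
    (∀ φ : ℝ≥0∞ → ℝ≥0∞, (∃ s t, φ s ≠ φ t) → Continuous φ → Monotone φ →
      ConvexOn ℝ≥0 Set.univ φ →
      (∃ tStar α : ℝ, zeroThreshold φ < ENNReal.ofReal tStar ∧ 0 < α ∧ α < 1 / ((n : ℝ) - 1) ∧
        ∫⁻ t in Set.Ioi tStar, (ENNReal.ofReal t / φ (ENNReal.ofReal t)) ^ α < ⊤) →
      IsCompactFamily (orliczSobolevFamily m D x₀ φ M)) ∧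
    (∀ p : ℝ, (n : ℝ) < p → IsCompactFamily (orliczSobolevFamily m D x₀ (fun t => t ^ p) M)) := by
  have main : ∀ φ : ℝ≥0∞ → ℝ≥0∞, Continuous φ → Monotone φ → ConvexOn ℝ≥0 Set.univ φ →
      (∃ tStar α : ℝ, zeroThreshold φ < ENNReal.ofReal tStar ∧ 0 < α ∧ α < 1 / ((n : ℝ) - 1) ∧
        ∫⁻ t in Set.Ioi tStar, (ENNReal.ofReal t / φ (ENNReal.ofReal t)) ^ α < ⊤) →
      IsCompactFamily (orliczSobolevFamily m D x₀ φ M) := by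
    rintro φ hφc hφm hconv ⟨a, α, ha, hα, hαn, hint⟩
    exact isCompactFamily_of_lintegral_lt_top hn hD_open hD_conn hφc hφm hconv ha hα hαn hint x₀ M
  refine ⟨fun φ _ => main φ, fun p hp => ?_⟩
  have hn2 : (2 : ℝ) ≤ n := by exact_mod_cast hn
  -- For `φ t = t ^ p` the integral converges when `α > 1/(p-1)`, and `p > n` leaves room below
  -- `1/(n-1)`.
  obtain ⟨α, hα, hαn⟩ := exists_between
    (one_div_lt_one_div_of_lt (by linarith : (0 : ℝ) < n - 1) (by linarith : (n : ℝ) - 1 < p - 1))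
  have hα0 : 0 < α := lt_trans (by have : 0 < p - 1 := by linarith
                                   positivity) hα
  refine main _ (ENNReal.continuous_rpow_const) (fun s t h => ENNReal.rpow_le_rpow h (by linarith))
    (convexOn_ennreal_rpow (by linarith)) ⟨1, α, ?_, hα0, hαn,
      lintegral_div_rpow_rpow_lt_top (by linarith) hα⟩
  rw [zeroThreshold_rpow (by linarith)]
  simp
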